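/- Let $k$ be a field of characteristic zero and $K\supseteq k$ an algebraically closed extension field (for instance $k=K=\mathbb C$, or $k=\mathbb R$, $K=\mathbb C$). Let $\mathbb P^n=\mathbb P^n(K)$ carry the Zariski topology, and let "hypersurface of degree $d$" mean the zero set in $\mathbb P^n$ of a nonzero form of degree $d$ in $x_0,\dots,x_n$ with coefficients in $k$ (together with this form). A subset $V\subset\mathbb P^n$ is called a complete intersection of $c$ hypersurfaces $h_1=0,\dots,h_c=0$ if it is their intersection, all irreducible components of $V$ have dimension $n-c$, and at a generic point $x$ of each component of $V$ (all points of some nonempty open part of it) the tangent hyperplanes of the $c$ hypersurfaces are in general position in $T_x\mathbb P^n$, that is, the differentials of $h_1,\dots,h_c$ at $x$ are linearly independent. An algebraic set $V$ is smooth at $p\in V$ if the dimension of its Zariski tangent space at $p$ (the common kernel in $T_p\mathbb P^n$ of the differentials at $p$ of all forms vanishing on $V$) equals the dimension of $V$ at $p$. **Proposition.** Let $d\ge 1$ and $0\le r\le n$. Suppose that $W\subset\mathbb P^n$ is a complete intersection of $r$ hypersurfaces of degree $d$ which is smooth at each of its points, and that $V\supseteq W$ is an algebraic subset of $\mathbb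 P^n$ that is, set-theoretically, an intersection of (any number of) hypersurfaces of degree $d$. Then $V$ is a complete intersection of $c$ hypersurfaces of degree $d$ for some $c\ge 0$, and $V$ is smooth at every point of $W$. (The empty intersection is $\mathbb P^n$.) -/

import Mathlib

open MvPolynomial

noncomputable section

namespace ProjAlg

/-- The projective space `ℙⁿ(K)`: the set of lines in `K^(n+1)`. -/
abbrev ProjSpace (n : ℕ) (K : Type*) [Field K] : Type _ :=
  Projectivization K (Fin (n + 1) → K)

section Geometry

variable {n : ℕ} {K : Type*} [Field K]

/-- The Zariski topology on `ℙⁿ(K)`: generated by the complements of the zero loci of homogeneous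
polynomials.  (Being the zero of a homogeneous polynomial does not depend on the representative.)
Its closed sets are the algebraic subsets of `ℙⁿ(K)`. -/
instance zariskiTopology : TopologicalSpace (ProjSpace n K) :=
  TopologicalSpace.generateFrom
    {U | ∃ (m : ℕ) (f : MvPolynomial (Fin (n + 1)) K), f.IsHomogeneous m ∧
      U = {x : ProjSpace n K | eval x.rep f ≠ 0}}

/-- `Z` is an irreducible component of `V`: a maximal irreducible subset of `V` for the Zariski
topology. -/
def IsComponent (V Z : Set (ProjSpace n K)) : Prop :=
  Maximal (fun Y : Set (ProjSpace n K) => IsIrreducible Y ∧ Y ⊆ V) Z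

/-- The set of all homogeneous coordinate vectors of points of `V` (the affine cone over `V`
without its vertex). -/
def cone (V : Set (ProjSpace n K)) : Set (Fin (n + 1) → K) :=
  {v | ∃ hv : v ≠ 0, Projectivization.mk K v hv ∈ V}

/-- The zero ideal `I(V)` of `V` in `K[x₀, …, xₙ]`. -/
def zeroIdeal (V : Set (ProjSpace n K)) : Ideal (MvPolynomial (Fin (n + 1)) K) :=
  vanishingIdeal K (cone V)

/-- The dimension of the affine cone over `V`, that is, the Krull dimension of the homogeneous
coordinate ring `K[x₀, …, xₙ] / I(V)`.  For nonempty `V` this is `dim V + 1`. -/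
def coneDim (V : Set (ProjSpace n K)) : WithBot ℕ∞ :=
  ringKrullDim (MvPolynomial (Fin (n + 1)) K ⧸ zeroIdeal V)

/-- The dimension of the affine cone over `V` locally at a coordinate vector of `p`: the largest
`coneDim` of an irreducible component of `V` through `p`.  This is `dim_p V + 1`. -/
def localConeDim (V : Set (ProjSpace n K)) (p : ProjSpace n K) : WithBot ℕ∞ :=
  ⨆ (Z : Set (ProjSpace n K)) (_ : IsComponent V Z ∧ p ∈ Z), coneDim Z

/-- The vector of partial derivatives, at the coordinate vector `p.rep` of `p`, of a polynomial `f`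
with coefficients in a subfield `k` of `K`.  For a homogeneous `f` vanishing at `p` this linear form
on `K^(n+1)` kills `p.rep`, so it is a linear form on `T_p ℙⁿ ≅ K^(n+1) / K p.rep`, namely the
differential at `p` of a local equation of `f = 0`. -/
def gradientAt {k : Type*} [Field k] [Algebra k K] (f : MvPolynomial (Fin (n + 1)) k)
    (p : ProjSpace n K) : Fin (n + 1) → K :=
  fun i => aeval p.rep (pderiv i f)

/-- The common kernel in `K^(n+1)` of the differentials at `p` of all elements of `I(V)`: the
Zariski tangent space of the affine cone over `V` at `p.rep`.  Its quotient by the line `p` is the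
Zariski tangent space `T_p V`. -/
def coneTangentSpace (V : Set (ProjSpace n K)) (p : ProjSpace n K) :
    Submodule K (Fin (n + 1) → K) where
  carrier := {w | ∀ f ∈ zeroIdeal V, ∑ i, gradientAt f p i * w i = 0}
  zero_mem' := by simp
  add_mem' := by
    intro a b ha hb f hf
    simp [mul_add, Finset.sum_add_distrib, ha f hf, hb f hf]
  smul_mem' := by
    intro c a ha f hf
    have h := ha f hf
    simp only [Pi.smul_apply, smul_eq_mul, mul_left_comm _ c, ← Finset.mul_sum, h, mul_zero]

/-- The algebraic set `V` is smooth (nonsingular) at its point `p`: `dim T_p V = dim_p V` (both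
sides are written for the affine cone, which adds one to each). -/
def IsSmoothAt (V : Set (ProjSpace n K)) (p : ProjSpace n K) : Prop :=
  p ∈ V ∧ ((Module.finrank K (coneTangentSpace V p) : ℕ) : WithBot ℕ∞) = localConeDim V p

end Geometry

/-- `f` is an equation of a hypersurface of degree `d`: a nonzero form of degree `d`. -/
def IsForm {n : ℕ} {k : Type*} [Field k] (d : ℕ) (f : MvPolynomial (Fin (n + 1)) k) : Prop :=
  f ≠ 0 ∧ f.IsHomogeneous d

/-- The set of `K`-points of the hypersurface `f = 0`, where `f` is a form over a subfield `k`. -/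
def hypersurface {n : ℕ} {k : Type*} (K : Type*) [Field k] [Field K] [Algebra k K]
    (f : MvPolynomial (Fin (n + 1)) k) : Set (ProjSpace n K) :=
  {x | aeval x.rep f = 0}

/-- `V ⊆ ℙⁿ(K)` is a complete intersection of type `(D 0, …, D (c - 1))` defined over `k`: it is the
intersection of `c` hypersurfaces `h j = 0` of degrees `D j` with coefficients in `k`, it is purely
`(n - c)`-dimensional, and at the generic point of each component of `V` (on a nonempty Zariski
open part of it) the tangent hyperplanes of the hypersurfaces are in general position, i.e. the
differentials of the `h j` are linearly independent. -/
def IsCompleteIntersection {n : ℕ} (k : Type*) {K : Type*} [Field k] [Field K] [Algebra k K]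
    {c : ℕ} (D : Fin c → ℕ) (V : Set (ProjSpace n K)) : Prop :=
  (∀ Z, IsComponent V Z → coneDim Z + (c : WithBot ℕ∞) = ((n + 1 : ℕ) : WithBot ℕ∞)) ∧
  ∃ h : Fin c → MvPolynomial (Fin (n + 1)) k,
    (∀ j, IsForm (D j) (h j)) ∧
    V = ⋂ j, hypersurface K (h j) ∧
    ∀ Z, IsComponent V Z → ∃ U : Set (ProjSpace n K), IsOpen U ∧ (Z ∩ U).Nonempty ∧
      ∀ x ∈ Z ∩ U, LinearIndependent K (fun j => gradientAt (h j) x)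

end ProjAlg

end

/-! The equations `h j` of `W` cut out the expected dimension, so they form a regular sequence and
generate an unmixed ideal (Macaulay). Independent differentials at one point of each component make
this ideal generically reduced, and an unmixed, generically reduced ideal is radical. Hence `I(W) =
(h 1, …, h r)` (`zeroIdeal_projZero_span`), and `W` is smooth at `p` exactly when the differentials
of the `h j` at `p` are independent (`isSmoothAt_iff`).

A form of degree `d` vanishing on `W` therefore lies in the degree `d` part of `(h 1, …, h r)`, that
is, in the `K`-span of the `h j`. Choose a basis `g 1, …, g c` of the span of the equations of `V`
among these equations, and complete it by `e 1, …, e a` to a basis of the span of the `h j`; then `c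
+ a ≤ r ≤ n`. Since `a` further forms cut `W` out of `V = {g = 0}`, the cone over `V` has dimension
at most `n + 1 - c`, and unmixedness makes `V` equidimensional. Each component has cone dimension `n
+ 1 - c > a`, so it meets `{e = 0}`, hence `W` (`inter_nonempty_of_isComponent`). At a point of `W`
taking differentials is injective on the span of the `h j`, so the differentials of the `g i` are
independent there, and by openness generically on every component of `V`. The smoothness criterion
applied to the `g i` gives smoothness along `W`.

Unmixedness rests on two facts: an ideal of codimension `t` contains a regular sequence of length
`t` (Nagata's change of variables), and regular sequences inside an ideal extend up to its grade
(Rees, via Ext). -/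

noncomputable section

attribute [local instance] MvPolynomial.gradedAlgebra

/-! ### Krull dimension: integral extensions and quotients by primes -/

section KrullDimIntegral

variable {R S : Type*} [CommRing R] [CommRing S]

theorem ringKrullDim_le_of_isIntegral [Algebra R S] [Algebra.IsIntegral R S] :
    ringKrullDim S ≤ ringKrullDim R :=
  Order.krullDim_le_of_strictMono (PrimeSpectrum.comap (algebraMap R S)) fun P Q h =>
    Ideal.IsIntegral.comap_lt_comap (R := R) (I := P.asIdeal) (J := Q.asIdeal) h

theorem ringKrullDim_le_of_isIntegral_of_injective [Algebra R S] [Algebra.IsIntegral R S]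
    (hinj : Function.Injective (algebraMap R S)) : ringKrullDim R ≤ ringKrullDim S := by
  refine iSup_le fun l => ?_
  obtain ⟨P, _, hP, hPl⟩ := Ideal.exists_ideal_over_prime_of_isIntegral (S := S)
    l.head.asIdeal ⊥ (by
      rw [← RingHom.ker_eq_comap_bot, (RingHom.injective_iff_ker_eq_bot _).mp hinj]
      exact bot_le)
  have : P.LiesOver l.head.asIdeal := ⟨hPl.symm⟩
  obtain ⟨L, hL, -, -⟩ := Ideal.exists_ltSeries_of_hasGoingUp l P
  rw [← hL]
  exact Order.LTSeries.length_le_krullDim L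

theorem ringKrullDim_quotient_le_of_le {I J : Ideal R} (h : I ≤ J) :
    ringKrullDim (R ⧸ J) ≤ ringKrullDim (R ⧸ I) :=
  ringKrullDim_le_of_surjective (Ideal.Quotient.factor h) (Ideal.Quotient.factor_surjective h)

/-- In a quotient by an ideal, the dimension is bounded by that of the quotients by the minimal
primes. -/
theorem exists_minimalPrimes_le_ringKrullDim {I : Ideal R} {t : ℕ}
    (h : (t : WithBot ℕ∞) ≤ ringKrullDim (R ⧸ I)) :
    ∃ Q ∈ I.minimalPrimes, (t : WithBot ℕ∞) ≤ ringKrullDim (R ⧸ Q) := by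
  rw [ringKrullDim_quotient] at h
  obtain ⟨l, hl⟩ := Order.le_krullDim_iff.mp h
  obtain ⟨Q, hQ, hQl⟩ := Ideal.exists_minimalPrimes_le (I := I) (J := l.head.1.asIdeal)
    l.head.2
  refine ⟨Q, hQ, ?_⟩
  rw [ringKrullDim_quotient]
  refine Order.le_krullDim_iff.mpr ⟨⟨l.length, fun i => ⟨(l i).1, ?_⟩, fun i => l.step i⟩, hl⟩
  have : l.head ≤ l i := l.monotone (Fin.zero_le i)
  exact hQl.trans this

theorem ringKrullDim_quotient_le_of_minimalPrimes {I : Ideal R} {t : ℕ}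
    (h : ∀ Q ∈ I.minimalPrimes, ringKrullDim (R ⧸ Q) ≤ t) : ringKrullDim (R ⧸ I) ≤ t := by
  by_contra hc
  rw [not_le] at hc
  have : ((t + 1 : ℕ) : WithBot ℕ∞) ≤ ringKrullDim (R ⧸ I) := by
    revert hc
    cases ringKrullDim (R ⧸ I) with
    | bot => simp
    | coe a =>
      intro hc
      have hc' : (t : ℕ∞) < a := by exact_mod_cast hc
      exact_mod_cast Order.add_one_le_of_lt hc'
  obtain ⟨Q, hQ, hle⟩ := exists_minimalPrimes_le_ringKrullDim this
  have := hle.trans (h Q hQ)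
  norm_cast at this
  omega

/-- If the inclusion were strict, `P` could be prepended to a chain of length `t` above `Q`. -/
theorem Ideal.eq_of_le_of_ringKrullDim_le {P Q : Ideal R} [P.IsPrime] [Q.IsPrime] (hPQ : P ≤ Q)
    {t : ℕ} (hP : ringKrullDim (R ⧸ P) ≤ t) (hQ : (t : WithBot ℕ∞) ≤ ringKrullDim (R ⧸ Q)) :
    P = Q := by
  by_contra hne
  have hlt : P < Q := lt_of_le_of_ne hPQ hne
  rw [ringKrullDim_quotient] at hQ hP
  obtain ⟨l, hl⟩ := Order.le_krullDim_iff.mp hQ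
  let l' : LTSeries (PrimeSpectrum.zeroLocus (P : Set R)) :=
    ⟨l.length, fun i => ⟨(l i).1, hPQ.trans (l i).2⟩, fun i => l.step i⟩
  let l'' := l'.cons ⟨⟨P, inferInstance⟩, fun _ h => h⟩ (show _ < _ from
    lt_of_lt_of_le hlt (l.head.2 : Q ≤ _))
  have h2 := (Order.LTSeries.length_le_krullDim l'').trans hP
  have h3 : l''.length = t + 1 := by
    rw [← hl]
    exact RelSeries.cons_length _ _ _
  rw [h3] at h2
  norm_cast at h2
  omega

end KrullDimIntegral

/-! ### Nagata's change of variables -/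

section Nagata

variable {k : Type*} [Field k] {n : ℕ} (f : MvPolynomial (Fin (n + 1)) k)
variable (v w : Fin (n + 1) →₀ ℕ)

namespace NagataAut

local notation "base" => 2 + f.totalDegree
local notation "wt" => fun (i : Fin (n + 1)) => (2 + MvPolynomial.totalDegree f) ^ (i : ℕ)

variable {f v} in
lemma forall_ofFn_lt (vlt : ∀ i, v i < base) : ∀ l ∈ List.ofFn v, l < base := by
  grind

/-- The map `X_i ↦ X_i + c X_0 ^ (base ^ i)` for `i ≠ 0`, `X_0 ↦ X_0`. -/
abbrev shear (c : k) :
    MvPolynomial (Fin (n + 1)) k →ₐ[k] MvPolynomial (Fin (n + 1)) k :=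
  aeval fun i ↦ if i = 0 then X 0 else X i + c • X 0 ^ (wt i)

lemma shear_comp_neg (c : k) : (shear f c).comp (shear f (-c)) = AlgHom.id _ _ := by
  rw [comp_aeval, ← MvPolynomial.aeval_X_left]
  ext i v
  cases i using Fin.cases <;> simp

/-- The automorphism `shear f 1`. -/
abbrev shearEquiv := AlgEquiv.ofAlgHom (shear f 1) (shear f (-1))
  (shear_comp_neg f 1) (by simpa using shear_comp_neg f (-1))

/-- The exponents are the digits, in base `2 + f.totalDegree`, of the weighted sum, and digits are
unique. -/
lemma sum_wt_mul_ne (vlt : ∀ i, v i < base) (wlt : ∀ i, w i < base) (ne : v ≠ w) :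
    ∑ x : Fin (n + 1), wt x * v x ≠ ∑ x : Fin (n + 1), wt x * w x := by
  intro h
  refine ne <| Finsupp.ext <| congrFun <| List.ofFn_inj.mp ?_
  apply Nat.ofDigits_inj_of_len_eq (Nat.lt_add_right f.totalDegree one_lt_two)
    (by simp) (forall_ofFn_lt vlt) (forall_ofFn_lt wlt)
  simpa only [Nat.ofDigits_eq_sum_mapIdx, List.mapIdx_eq_ofFn, List.get_ofFn, List.length_ofFn,
    Fin.val_cast, mul_comm, List.sum_ofFn] using! h

lemma degreeOf_zero_shear {a : k} (ha : a ≠ 0) : ((shearEquiv f) (monomial v a)).degreeOf 0 =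
    ∑ i : Fin (n + 1), (wt i) * v i := by
  rw [← natDegree_finSuccEquiv, monomial_eq, Finsupp.prod_pow v fun a ↦ X a]
  simp only [Fin.prod_univ_succ, Fin.sum_univ_succ, map_mul, map_prod, map_pow,
    AlgEquiv.ofAlgHom_apply, MvPolynomial.aeval_C, MvPolynomial.aeval_X, if_pos, Fin.succ_ne_zero,
    ite_false, one_smul, map_add, finSuccEquiv_X_zero, finSuccEquiv_X_succ, algebraMap_eq]
  have h (i : Fin n) :
      (Polynomial.C (X (R := k) i) + Polynomial.X ^ wt i.succ) ^ v i.succ ≠ 0 :=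
    pow_ne_zero (v i.succ) (Polynomial.leadingCoeff_ne_zero.mp <| by
      simp [add_comm, Polynomial.leadingCoeff_X_pow_add_C])
  rw [Polynomial.natDegree_mul (by simp [ha]) (mul_ne_zero (by simp) (Finset.prod_ne_zero_iff.mpr
    (fun i _ ↦ h i))), Polynomial.natDegree_mul (by simp)
    (Finset.prod_ne_zero_iff.mpr (fun i _ ↦ h i)),
    Polynomial.natDegree_prod _ _ (fun i _ ↦ h i), natDegree_finSuccEquiv, degreeOf_C]
  simpa only [Polynomial.natDegree_pow, zero_add, Polynomial.natDegree_X, mul_one, Fin.val_zero,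
    pow_zero, one_mul, add_right_inj] using Finset.sum_congr rfl (fun i _ ↦ by
    rw [add_comm (Polynomial.C _), Polynomial.natDegree_X_pow_add_C, mul_comm])

lemma degreeOf_shear_ne (hv : v ∈ f.support) (hw : w ∈ f.support) (ne : v ≠ w) :
    (shearEquiv f <| monomial v <| coeff v f).degreeOf 0 ≠
    (shearEquiv f <| monomial w <| coeff w f).degreeOf 0 := by
  rw [degreeOf_zero_shear _ _ <| mem_support_iff.mp hv,
    degreeOf_zero_shear _ _ <| mem_support_iff.mp hw]
  refine sum_wt_mul_ne f v w (fun i ↦ ?_) (fun i ↦ ?_) ne <;>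
  exact lt_of_le_of_lt ((monomial_le_degreeOf i ‹_›).trans (degreeOf_le_totalDegree f i))
    (by lia)

lemma leadingCoeff_finSuccEquiv_shear :
    (finSuccEquiv k n ((shearEquiv f) ((monomial v) (coeff v f)))).leadingCoeff =
    algebraMap k _ (coeff v f) := by
  rw [monomial_eq, Finsupp.prod_fintype]
  · simp only [map_mul, map_prod, Polynomial.leadingCoeff_mul, Polynomial.leadingCoeff_prod]
    rw [AlgEquiv.ofAlgHom_apply, algHom_C, algebraMap_eq, finSuccEquiv_apply,
      eval₂Hom_C, RingHom.coe_comp]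
    simp only [AlgEquiv.ofAlgHom_apply, Function.comp_apply, Polynomial.leadingCoeff_C, map_pow,
      Polynomial.leadingCoeff_pow, algebraMap_eq]
    have : ∀ j, ((finSuccEquiv k n) ((shear f) 1 (X j))).leadingCoeff = 1 := fun j ↦ by
      by_cases h : j = 0
      · simp [h, finSuccEquiv_apply]
      · simp only [aeval_eq_bind₁, bind₁_X_right, if_neg h, one_smul, map_add, map_pow]
        obtain ⟨i, rfl⟩ := Fin.exists_succ_eq.mpr h
        simp [finSuccEquiv_X_succ, finSuccEquiv_X_zero, add_comm]
    simp only [this, one_pow, Finset.prod_const_one, mul_one]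
  exact fun i ↦ pow_zero _

/-- After the shear the monomials of `f` have pairwise distinct degrees in `X 0`. The one of largest
degree cannot cancel, and its leading coefficient is a nonzero constant. -/
lemma isUnit_leadingCoeff_shear (fne : f ≠ 0) :
    IsUnit (finSuccEquiv k n (shearEquiv f f)).leadingCoeff := by
  obtain ⟨v, vin, vs⟩ := Finset.exists_max_image f.support
    (fun v ↦ (shearEquiv f ((monomial v) (coeff v f))).degreeOf 0) (support_nonempty.mpr fne)
  set h := fun w ↦ (MvPolynomial.monomial w) (coeff w f)
  simp only [← natDegree_finSuccEquiv] at vs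
  replace vs : ∀ x ∈ f.support \ {v}, (finSuccEquiv k n ((shearEquiv f) (h x))).degree <
      (finSuccEquiv k n ((shearEquiv f) (h v))).degree := by
    intro x hx
    obtain ⟨h1, h2⟩ := Finset.mem_sdiff.mp hx
    apply Polynomial.degree_lt_degree <| lt_of_le_of_ne (vs x h1) ?_
    simpa only [natDegree_finSuccEquiv]
      using degreeOf_shear_ne f _ _ h1 vin <| by simpa using h2
  have coeff : (finSuccEquiv k n ((shearEquiv f)
      (h v + ∑ x ∈ f.support \ {v}, h x))).leadingCoeff =
      (finSuccEquiv k n ((shearEquiv f) (h v))).leadingCoeff := by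
    simp only [map_add, map_sum]
    rw [add_comm]
    apply Polynomial.leadingCoeff_add_of_degree_lt <|
      (lt_of_le_of_lt <| Polynomial.degree_sum_le _ _) ?_
    have h2 : h v ≠ 0 := by simpa [h] using mem_support_iff.mp vin
    replace h2 : (finSuccEquiv k n ((shearEquiv f) (h v))) ≠ 0 := fun eq ↦ h2 <|
      by simpa only [map_eq_zero_iff _ (AlgEquiv.injective _)] using eq
    exact (Finset.sup_lt_iff <| Ne.bot_lt (fun x ↦ h2 <| Polynomial.degree_eq_bot.mp x)).mpr vs
  nth_rw 2 [← f.support_sum_monomial_coeff]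
  rw [Finset.sum_eq_add_sum_sdiff_singleton_of_mem vin h]
  rw [leadingCoeff_finSuccEquiv_shear] at coeff
  simpa only [coeff, algebraMap_eq] using (mem_support_iff.mp vin).isUnit.map MvPolynomial.C

end NagataAut

end Nagata

/-! ### Grade is at least codimension -/

section RegularSequences

open RingTheory.Sequence Pointwise

/-- Regularity of `rs` survives the flat extension to polynomials. Modulo `rs`, `f` remains a unit
times a monic polynomial, hence a nonzerodivisor. -/
theorem RingTheory.Sequence.IsWeaklyRegular.map_C_append {R : Type*} [CommRing R] {rs : List R}
    (hrs : IsWeaklyRegular R rs) {f : Polynomial R} (hf : IsUnit f.leadingCoeff) :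
    IsWeaklyRegular (Polynomial R) (rs.map Polynomial.C ++ [f]) := by
  rw [isWeaklyRegular_append_iff]
  refine ⟨hrs.of_flat (S := Polynomial R), ?_⟩
  rw [isWeaklyRegular_singleton_iff, isSMulRegular_quotient_iff_mem_of_smul_mem]
  intro g hg
  have hI : (Ideal.ofList (rs.map Polynomial.C) • ⊤ : Submodule (Polynomial R) (Polynomial R)) =
      (Ideal.ofList rs).map Polynomial.C := by
    rw [Ideal.map_ofList]; simp
  have hker : (Ideal.ofList rs).map Polynomial.C =
      RingHom.ker (Polynomial.mapRingHom (Ideal.Quotient.mk (Ideal.ofList rs))) := by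
    rw [Polynomial.ker_mapRingHom, Ideal.mk_ker]
  rw [hI, hker, RingHom.mem_ker] at hg ⊢
  rw [smul_eq_mul, map_mul] at hg
  have hm := (Polynomial.monic_of_isUnit_leadingCoeff_inv_smul hf).map
    (Ideal.Quotient.mk (Ideal.ofList rs))
  rw [← hm.isRegular.left.mul_left_eq_zero_iff, Units.smul_def, Polynomial.smul_eq_C_mul,
    Polynomial.map_mul, mul_assoc]
  simp only [Polynomial.coe_mapRingHom] at hg ⊢
  rw [hg, mul_zero]

theorem exists_isWeaklyRegular_of_ringEquiv {R S : Type*} [CommRing R] [CommRing S] (e : R ≃+* S)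
    (I : Ideal S) {t : ℕ}
    (h : ∃ rs : List R, rs.length = t ∧ (∀ r ∈ rs, e r ∈ I) ∧ IsWeaklyRegular R rs) :
    ∃ rs : List S, rs.length = t ∧ (∀ r ∈ rs, r ∈ I) ∧ IsWeaklyRegular S rs := by
  obtain ⟨rs, hl, hI, hr⟩ := h
  refine ⟨rs.map e, by simpa, by simpa using hI, ?_⟩
  refine (AddEquiv.isWeaklyRegular_congr (e := e.toAddEquiv) (as := rs) ?_).mp hr
  exact List.forall₂_map_right_iff.mpr (List.forall₂_same.mpr fun r _ x => by simp)

/-- A polynomial in `I` with unit leading coefficient makes the injection of `R ⧸ (I ∩ R)` into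
`R[X] ⧸ I` integral. -/
theorem ringKrullDim_quotient_comap_C_le {R : Type*} [CommRing R] (I : Ideal (Polynomial R))
    {f : Polynomial R} (hfI : f ∈ I) (hf : IsUnit f.leadingCoeff) :
    ringKrullDim (R ⧸ I.comap Polynomial.C) ≤ ringKrullDim (Polynomial R ⧸ I) := by
  let φ : R ⧸ I.comap Polynomial.C →+* Polynomial R ⧸ I :=
    Ideal.quotientMap I Polynomial.C le_rfl
  let _ := φ.toAlgebra
  have hint : ((Ideal.Quotient.mk I).comp Polynomial.C).IsIntegral := by
    refine (Polynomial.monic_of_isUnit_leadingCoeff_inv_smul hf).quotient_isIntegral ?_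
    exact Submodule.smul_of_tower_mem _ _ hfI
  have : Algebra.IsIntegral (R ⧸ I.comap Polynomial.C) (Polynomial R ⧸ I) := by
    refine ⟨?_⟩
    refine RingHom.IsIntegral.tower_top (Ideal.Quotient.mk (I.comap Polynomial.C)) φ ?_
    exact hint
  exact ringKrullDim_le_of_isIntegral_of_injective Ideal.quotientMap_injective

/-- Every proper ideal of a polynomial ring has grade at least its codimension. -/
theorem MvPolynomial.exists_isWeaklyRegular_of_ringKrullDim_le {K : Type*} [Field K] (n : ℕ)
    (I : Ideal (MvPolynomial (Fin n) K)) (hI : I ≠ ⊤) (t : ℕ)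
    (ht : ringKrullDim (MvPolynomial (Fin n) K ⧸ I) + t ≤ n) :
    ∃ rs : List (MvPolynomial (Fin n) K), rs.length = t ∧ (∀ r ∈ rs, r ∈ I) ∧
      IsWeaklyRegular (MvPolynomial (Fin n) K) rs := by
  induction n generalizing t with
  | zero =>
    have := Ideal.Quotient.nontrivial_iff.mpr hI
    have h0 := ringKrullDim_nonneg_of_nontrivial (R := MvPolynomial (Fin 0) K ⧸ I)
    have : t = 0 := by
      have := (add_le_add_left h0 (t : WithBot ℕ∞)).trans ht
      rw [zero_add] at this
      exact Nat.le_zero.mp (by exact_mod_cast this)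
    subst this
    exact ⟨[], rfl, by simp, IsWeaklyRegular.nil _ _⟩
  | succ n ih =>
    by_cases hbot : I = ⊥
    · have hd : ringKrullDim (MvPolynomial (Fin (n + 1)) K ⧸ I) = (n + 1 : ℕ) := by
        rw [hbot, ringKrullDim_eq_of_ringEquiv (RingEquiv.quotientBot _),
          MvPolynomial.ringKrullDim_of_isNoetherianRing]
        simp
      have : t = 0 := by
        rw [hd] at ht
        norm_cast at ht
        omega
      subst this
      exact ⟨[], rfl, by simp, IsWeaklyRegular.nil _ _⟩
    · obtain ⟨f, fI, fne⟩ := Submodule.exists_mem_ne_zero_of_ne_bot hbot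
      -- In the new coordinates `f` has unit leading coefficient. Contracting `I` to one variable
      -- fewer does not raise the dimension of the quotient, so the contraction loses at most one in
      -- codimension; `f` supplies the missing member of the sequence.
      let e : MvPolynomial (Fin (n + 1)) K ≃+* Polynomial (MvPolynomial (Fin n) K) :=
        ((NagataAut.shearEquiv f).trans (finSuccEquiv K n)).toRingEquiv
      have hu : IsUnit (e f).leadingCoeff := NagataAut.isUnit_leadingCoeff_shear f fne
      let I' : Ideal (Polynomial (MvPolynomial (Fin n) K)) := I.comap e.symm
      have hfI' : e f ∈ I' := by simpa [I'] using fI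
      have hd1 : ringKrullDim (Polynomial (MvPolynomial (Fin n) K) ⧸ I') =
          ringKrullDim (MvPolynomial (Fin (n + 1)) K ⧸ I) :=
        ringKrullDim_eq_of_ringEquiv (Ideal.quotientEquiv I' I e.symm
          (Ideal.map_comap_of_surjective _ e.symm.surjective I).symm)
      have hd2 := ringKrullDim_quotient_comap_C_le I' hfI' hu
      rw [hd1] at hd2
      have hne : I'.comap Polynomial.C ≠ ⊤ := by
        refine fun h => hI ((Ideal.eq_top_iff_one _).mpr ?_)
        have h1 : e.symm (Polynomial.C 1) ∈ I :=
          show 1 ∈ I'.comap Polynomial.C from h ▸ Submodule.mem_top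
        simpa using h1
      cases t with
      | zero => exact ⟨[], rfl, by simp, IsWeaklyRegular.nil _ _⟩
      | succ t =>
        obtain ⟨rs, hl, hrI, hr⟩ := ih (I'.comap Polynomial.C) hne t (by
          have := (add_le_add_left hd2 ((t + 1 : ℕ) : WithBot ℕ∞)).trans ht
          revert this
          cases ringKrullDim (MvPolynomial (Fin n) K ⧸ I'.comap Polynomial.C) with
          | bot => simp
          | coe a =>
            cases a with
            | top =>
              intro h
              have h' : (⊤ : ℕ∞) + (t + 1 : ℕ) ≤ (n + 1 : ℕ) := by exact_mod_cast h
              rw [top_add, top_le_iff] at h'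
              exact absurd h' (ENat.natCast_ne_top _)
            | coe a => intro h; norm_cast at h ⊢; omega)
        refine exists_isWeaklyRegular_of_ringEquiv e.symm I
          ⟨rs.map Polynomial.C ++ [e f], by simp [hl], ?_, hr.map_C_append hu⟩
        intro r hr
        rw [List.mem_append] at hr
        rcases hr with hr | hr
        · obtain ⟨q, hq, rfl⟩ := List.mem_map.mp hr
          exact hrI q hq
        · rw [List.mem_singleton.mp hr]
          simpa using fI

end RegularSequences

/-! ### Extending regular sequences inside an ideal -/

section Rees

open RingTheory.Sequence CategoryTheory Abelian Limits Pointwise ModuleCat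

universe u
variable {R : Type u} [CommRing R]

theorem smul_top_quotSMulTop_ne_top {M : Type*} [AddCommGroup M] [Module R M] {I : Ideal R} {r : R}
    (hr : r ∈ I) (hI : I • (⊤ : Submodule R M) ≠ ⊤) :
    I • (⊤ : Submodule R (QuotSMulTop r M)) ≠ ⊤ := by
  by_contra eq
  absurd congrArg (Submodule.comap (Submodule.mkQ _)) eq
  simpa [Submodule.comap_smul_top_of_surjective I _ (Submodule.mkQ_surjective _),
    Submodule.smul_mono_left ((Ideal.span_singleton_le_iff_mem I).mpr hr),
    ← Submodule.ideal_span_singleton_smul] using hI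

/-- Dividing out a regular element lowers the grade by at most one. -/
theorem exists_isRegular_quotSMulTop [IsNoetherianRing R] (I : Ideal R) (M : Type u)
    [AddCommGroup M] [Module R M] [Module.Finite R M] (hI : I • (⊤ : Submodule R M) ≠ ⊤) {r : R}
    (hr : r ∈ I) (hreg : IsSMulRegular M r) {n : ℕ}
    (h : ∃ rs : List R, rs.length = n + 1 ∧ (∀ r ∈ rs, r ∈ I) ∧ IsRegular M rs) :
    ∃ rs : List R, rs.length = n ∧ (∀ r ∈ rs, r ∈ I) ∧ IsRegular (QuotSMulTop r M) rs := by
  -- Grade is measured by vanishing of Ext. In the long exact sequence of multiplication by `r`, the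
  -- group Ext^i into `M/rM` sits between Ext^i and Ext^(i+1) into `M`.
  have h1 := ((ModuleCat.exists_isRegular_tfae I (n + 1) (ModuleCat.of R M) hI.lt_top).out 3 1).mp h
  refine ((ModuleCat.exists_isRegular_tfae I n (ModuleCat.of R (QuotSMulTop r M))
    (smul_top_quotSMulTop_ne_top hr hI).lt_top).out 1 3).mp fun i hi => ?_
  have zero1 := AddCommGrpCat.isZero_of_iff_subsingleton.mpr (h1 i (by omega))
  have zero2 := AddCommGrpCat.isZero_of_iff_subsingleton.mpr (h1 (i + 1) (by omega))
  have hreg' : IsSMulRegular (ModuleCat.of R M) r := hreg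
  exact AddCommGrpCat.subsingleton_of_isZero <| ShortComplex.Exact.isZero_of_both_zeros
    ((Ext.covariant_sequence_exact₃' _ hreg'.smulShortComplex_shortExact) i (i + 1) rfl)
    (zero1.eq_zero_of_src _) (zero2.eq_zero_of_tgt _)

/-- Each member of `as` lowers the grade by at most one, so grade at least one remains after
dividing out all of them. -/
theorem exists_isSMulRegular_quotient_ofList [IsNoetherianRing R] (I : Ideal R) (as : List R)
    (has : ∀ a ∈ as, a ∈ I) (M : Type u)
    [AddCommGroup M] [Module R M] [Module.Finite R M] (hI : I • (⊤ : Submodule R M) ≠ ⊤)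
    (hreg : IsWeaklyRegular M as)
    (h : ∃ rs : List R, rs.length = as.length + 1 ∧ (∀ r ∈ rs, r ∈ I) ∧ IsRegular M rs) :
    ∃ a ∈ I, IsSMulRegular (M ⧸ (Ideal.ofList as • ⊤ : Submodule R M)) a := by
  induction as generalizing M with
  | nil =>
    obtain ⟨rs, hl, hrI, hr⟩ := h
    match rs, hl with
    | [a], _ =>
      refine ⟨a, hrI a (by simp), ?_⟩
      have e : (M ⧸ (Ideal.ofList ([] : List R) • ⊤ : Submodule R M)) ≃ₗ[R] M :=
        Submodule.quotEquivOfEqBot _ (by simp)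
      rw [e.isSMulRegular_congr]
      exact (isWeaklyRegular_singleton_iff M a).mp hr.toIsWeaklyRegular
  | cons b bs ih =>
    rw [isWeaklyRegular_cons_iff] at hreg
    have hb : b ∈ I := has b (by simp)
    obtain ⟨a, haI, ha⟩ := ih (fun a ha => has a (by simp [ha])) (QuotSMulTop b M)
      (smul_top_quotSMulTop_ne_top hb hI) hreg.2 (exists_isRegular_quotSMulTop I M hI hb hreg.1 h)
    exact ⟨a, haI, ((Submodule.quotOfListConsSMulTopEquivQuotSMulTopInner M b
      bs).isSMulRegular_congr a).mpr ha⟩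

end Rees

/-- **Macaulay unmixedness**: modulo a regular sequence of length `c` in a polynomial ring in `n`
variables, the annihilator of a nonzero element has dimension at least `n - c`. -/
theorem MvPolynomial.lt_ringKrullDim_add_of_mul_mem {K : Type*} [Field K] {n : ℕ}
    {as : List (MvPolynomial (Fin n) K)}
    (hreg : RingTheory.Sequence.IsWeaklyRegular (MvPolynomial (Fin n) K) as)
    {J : Ideal (MvPolynomial (Fin n) K)} (has : ∀ a ∈ as, a ∈ J) {f : MvPolynomial (Fin n) K}
    (hf : f ∉ Ideal.ofList as) (hJ : ∀ a ∈ J, a * f ∈ Ideal.ofList as) :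
    ¬ (ringKrullDim (MvPolynomial (Fin n) K ⧸ J) + (as.length + 1 : ℕ) ≤ n) := by
  intro hd
  have hJtop : J ≠ ⊤ := by
    intro h
    exact hf (by simpa using hJ 1 (h ▸ Submodule.mem_top))
  -- If `J` had codimension greater than `as.length`, it would contain an element regular modulo
  -- `as`; but `J` kills `f` modulo `as`.
  obtain ⟨rs, hl, hrJ, hr⟩ := exists_isWeaklyRegular_of_ringKrullDim_le n J hJtop _ hd
  have hJ' : J • (⊤ : Submodule (MvPolynomial (Fin n) K) (MvPolynomial (Fin n) K)) ≠ ⊤ := by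
    simpa using hJtop
  obtain ⟨a, haJ, ha⟩ := exists_isSMulRegular_quotient_ofList J as has _ hJ' hreg
    ⟨rs, hl, hrJ, hr, fun h => hJ' (top_le_iff.mp (h.le.trans (Submodule.smul_mono_left
      (Ideal.span_le.mpr hrJ))))⟩
  rw [isSMulRegular_quotient_iff_mem_of_smul_mem] at ha
  simp only [smul_eq_mul, Ideal.mul_top] at ha
  exact hf (ha f (hJ a haJ))

/-! ### Homogeneous ideals and dimension of graded quotients -/

section Graded

variable {σ R : Type*} [CommRing R]

theorem MvPolynomial.homogeneousComponent_mul_of_isHomogeneous {b : MvPolynomial σ R} {m : ℕ}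
    (hb : b.IsHomogeneous m) (a : MvPolynomial σ R) (e : ℕ) :
    homogeneousComponent e (a * b) =
      if m ≤ e then homogeneousComponent (e - m) a * b else 0 := by
  have h := DirectSum.coe_decompose_mul_of_right_mem (homogeneousSubmodule σ R) (a := a) e
    (i := m) (b := b) hb
  have hd : ∀ (p : MvPolynomial σ R) (i : ℕ),
    (DirectSum.decompose (homogeneousSubmodule σ R) p i : MvPolynomial σ R) =
      homogeneousComponent i p := fun p i => decomposition.decompose'_apply p i
  rwa [hd, hd] at h

theorem Ideal.isHomogeneous_of_homogeneousComponent_mem {I : Ideal (MvPolynomial σ R)}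
    (h : ∀ f ∈ I, ∀ i, homogeneousComponent i f ∈ I) :
    I.IsHomogeneous (homogeneousSubmodule σ R) := by
  intro i f hf
  have := h f hf i
  rwa [← decomposition.decompose'_apply] at this

theorem Ideal.isHomogeneous_span_range {ι : Type*} {e : ι → MvPolynomial σ R} {m : ι → ℕ}
    (he : ∀ i, (e i).IsHomogeneous (m i)) :
    (Ideal.span (Set.range e)).IsHomogeneous (homogeneousSubmodule σ R) := by
  refine Ideal.homogeneous_span _ _ ?_
  rintro _ ⟨i, rfl⟩
  exact ⟨m i, he i⟩

/-- The homogeneous core of `Q` is again a prime containing `I`, so minimality makes it equal to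
`Q`. -/
theorem Ideal.isHomogeneous_of_mem_minimalPrimes {I Q : Ideal (MvPolynomial σ R)}
    (hI : I.IsHomogeneous (homogeneousSubmodule σ R)) (hQ : Q ∈ I.minimalPrimes) :
    Q.IsHomogeneous (homogeneousSubmodule σ R) := by
  have hp := Ideal.IsPrime.homogeneousCore (𝒜 := homogeneousSubmodule σ R) hQ.1.1
  have hle := Ideal.toIdeal_homogeneousCore_le (homogeneousSubmodule σ R) Q
  have hIQ : I ≤ (Q.homogeneousCore (homogeneousSubmodule σ R)).toIdeal := by
    rw [← hI.toIdeal_homogeneousCore_eq_self]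
    exact Ideal.homogeneousCore_mono _ hQ.1.2
  have : (Q.homogeneousCore (homogeneousSubmodule σ R)).toIdeal = Q :=
    le_antisymm hle (hQ.2 ⟨hp, hIQ⟩ hle)
  rw [← this]
  exact HomogeneousIdeal.isHomogeneous _

theorem MvPolynomial.sub_C_mem_idealOfVars (f : MvPolynomial σ R) :
    f - C (coeff 0 f) ∈ idealOfVars σ R := by
  rw [← pow_one (idealOfVars σ R), mem_pow_idealOfVars_iff']
  intro x hx
  have : x = 0 := by
    rwa [Nat.lt_one_iff, Finsupp.degree_eq_zero_iff] at hx
  simp [this]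

end Graded

section Field

variable {σ K : Type*} [Field K]

/-- The irrelevant ideal contains every proper homogeneous ideal. -/
theorem Ideal.IsHomogeneous.le_idealOfVars {I : Ideal (MvPolynomial σ K)}
    (hI : I.IsHomogeneous (homogeneousSubmodule σ K)) (hne : I ≠ ⊤) : I ≤ idealOfVars σ K := by
  intro f hf
  have h0 := homogeneousComponent_mem_of_mem hI hf 0
  rw [homogeneousComponent_zero] at h0
  have : coeff 0 f = 0 := by
    by_contra hc
    exact hne (Ideal.eq_top_of_isUnit_mem _ h0 ((isUnit_iff_ne_zero.mpr hc).map C))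
  simpa [this] using sub_C_mem_idealOfVars f

theorem MvPolynomial.ringKrullDim_quotient_le_zero {I : Ideal (MvPolynomial σ K)}
    (h : idealOfVars σ K ≤ I) : ringKrullDim (MvPolynomial σ K ⧸ I) ≤ 0 := by
  rw [← ringKrullDim_eq_zero_of_field K]
  refine ringKrullDim_le_of_surjective ((Ideal.Quotient.mk I).comp C) fun y => ?_
  obtain ⟨f, rfl⟩ := Ideal.Quotient.mk_surjective y
  exact ⟨coeff 0 f, ((Ideal.Quotient.eq).mpr (h (sub_C_mem_idealOfVars f))).symm⟩

instance MvPolynomial.isMaximal_idealOfVars : (idealOfVars σ K).IsMaximal := by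
  have : idealOfVars σ K = RingHom.ker (constantCoeff : MvPolynomial σ K →+* K) := by
    refine le_antisymm (Ideal.span_le.mpr ?_) fun f hf => ?_
    · rintro _ ⟨i, rfl⟩
      simp
    · have h0 : coeff 0 f = 0 := hf
      simpa [h0] using sub_C_mem_idealOfVars f
  rw [this]
  exact RingHom.ker_isMaximal_of_surjective _ fun a => ⟨C a, by simp⟩

/-- A graded quotient of a polynomial ring is integral over the subalgebra generated by homogeneous
elements of positive degree that cut out the vertex only. -/
theorem MvPolynomial.ringKrullDim_le_card_of_surjective [Finite σ] {ι : Type*} [Fintype ι]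
    {B : Type*} [CommRing B] [Algebra K B] (π : MvPolynomial σ K →ₐ[K] B)
    (hπ : Function.Surjective π)
    (hJ : (RingHom.ker π).IsHomogeneous (homogeneousSubmodule σ K))
    (e : ι → MvPolynomial σ K) (m : ι → ℕ) (he : ∀ i, (e i).IsHomogeneous (m i))
    (hm : ∀ i, 0 < m i)
    (hrad : idealOfVars σ K ≤ (RingHom.ker π ⊔ Ideal.span (Set.range e)).radical) :
    ringKrullDim B ≤ Fintype.card ι := by
  obtain ⟨k, hk⟩ := Ideal.exists_pow_le_of_le_radical_of_fg hrad (idealOfVars_fg σ K)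
  let φ : MvPolynomial ι K →ₐ[K] B := aeval fun i => π (e i)
  let _ := φ.toRingHom.toAlgebra
  have hsmul : ∀ (r : MvPolynomial ι K) (x : B), r • x = φ r * x := fun _ _ => rfl
  -- The images of the monomials of degree less than `k` will generate `B` as a module over the
  -- polynomial ring in the `e i`.
  let s : Set B := (fun d : σ →₀ ℕ => π (monomial d 1)) '' {d | d.degree < k}
  have hs : s.Finite :=
    ((Finsupp.finite_of_degree_le k).subset fun d (hd : d.degree < k) => hd.le).image _
  let M : Submodule (MvPolynomial ι K) B := Submodule.span _ s
  have hC : ∀ (a : K) (x : MvPolynomial σ K), π x ∈ M → π (C a * x) ∈ M := by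
    intro a x hx
    have := M.smul_mem (C a) hx
    rw [hsmul] at this
    simp only [φ, algHom_C] at this
    rw [map_mul, algHom_C]
    exact this
  have hdeg : ∀ {n : ℕ} {f : MvPolynomial σ K}, f.IsHomogeneous n → ∀ d ∈ f.support,
      d.degree = n := fun hf d hd => (hf.degree_eq_sum_deg_support hd).symm
  have hlow : ∀ f : MvPolynomial σ K, (∀ d ∈ f.support, d.degree < k) → π f ∈ M := by
    intro f hf
    rw [f.as_sum, map_sum]
    refine M.sum_mem fun d hd => ?_
    rw [← mul_one (coeff d f), ← C_mul_monomial]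
    exact hC _ _ (Submodule.subset_span ⟨d, hf d hd, rfl⟩)
  have key : ∀ (n : ℕ) (f : MvPolynomial σ K), f.IsHomogeneous n → π f ∈ M := by
    intro n
    induction n using Nat.strong_induction_on with
    | _ n ih =>
      intro f hf
      by_cases hn : n < k
      · exact hlow f fun d hd => by rwa [hdeg hf d hd]
      -- From degree `k` on, a form is, modulo the kernel, a combination of the `e i`. Its degree
      -- `n` part has coefficients of degree `n - m i < n`, to which induction applies.
      · have hfk : f ∈ idealOfVars σ K ^ k := by
          rw [mem_pow_idealOfVars_iff]
          intro d hd
          rw [hdeg hf d hd]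
          omega
        obtain ⟨j, hj, g, hg, hfg⟩ := Submodule.mem_sup.mp (hk hfk)
        obtain ⟨a, rfl⟩ := (Ideal.mem_span_range_iff_exists_fun).mp hg
        have hcomp : f = homogeneousComponent n j +
            ∑ i, if m i ≤ n then homogeneousComponent (n - m i) (a i) * e i else 0 := by
          conv_lhs => rw [← homogeneousComponent_eq_self hf, ← hfg, map_add, map_sum]
          simp only [homogeneousComponent_mul_of_isHomogeneous (he _)]
        have hj0 : π (homogeneousComponent n j) = 0 := homogeneousComponent_mem_of_mem hJ hj n
        rw [hcomp, map_add, hj0, zero_add, map_sum]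
        refine M.sum_mem fun i _ => ?_
        split_ifs with hi
        · have := M.smul_mem (X i) (ih (n - m i) (by have := hm i; omega) _
            (homogeneousComponent_isHomogeneous (n - m i) (a i)))
          rw [hsmul] at this
          simp only [φ, aeval_X] at this
          rw [mul_comm, map_mul]
          exact this
        · simp
  have : Module.Finite (MvPolynomial ι K) B := by
    refine ⟨?_⟩
    have hMtop : M = ⊤ := by
      rw [eq_top_iff]
      intro x _
      obtain ⟨f, rfl⟩ := hπ x
      rw [← sum_homogeneousComponent f, map_sum]
      exact M.sum_mem fun i _ => key i _ (homogeneousComponent_isHomogeneous i f)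
    rw [← hMtop]
    exact Submodule.fg_span hs
  have h1 := ringKrullDim_le_of_isIntegral (R := MvPolynomial ι K) (S := B)
  rwa [MvPolynomial.ringKrullDim_of_isNoetherianRing, ringKrullDim_eq_zero_of_field, zero_add,
    Nat.card_eq_fintype_card] at h1

theorem MvPolynomial.ringKrullDim_le_card_of_le_radical [Finite σ] {ι : Type*} [Fintype ι]
    {J : Ideal (MvPolynomial σ K)} (hJ : J.IsHomogeneous (homogeneousSubmodule σ K))
    (e : ι → MvPolynomial σ K) (m : ι → ℕ) (he : ∀ i, (e i).IsHomogeneous (m i))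
    (hm : ∀ i, 0 < m i)
    (hrad : idealOfVars σ K ≤ (J ⊔ Ideal.span (Set.range e)).radical) :
    ringKrullDim (MvPolynomial σ K ⧸ J) ≤ Fintype.card ι := by
  have hker : RingHom.ker (Ideal.Quotient.mkₐ K J) = J := Ideal.Quotient.mkₐ_ker K J
  exact ringKrullDim_le_card_of_surjective (Ideal.Quotient.mkₐ K J)
    (Ideal.Quotient.mkₐ_surjective K J) (by rwa [hker]) e m he hm (by rwa [hker])

/-- Linear forms avoiding finitely many primes other than the irrelevant ideal. -/
theorem MvPolynomial.exists_linear_form_notMem [Infinite K] (s : Set (Ideal (MvPolynomial σ K)))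
    (hs : s.Finite) (hne : ∀ Q ∈ s, ¬ idealOfVars σ K ≤ Q) :
    ∃ u : MvPolynomial σ K, u.IsHomogeneous 1 ∧ ∀ Q ∈ s, u ∉ Q := by
  have := hs.to_subtype
  let p : s → Submodule K (homogeneousSubmodule σ K 1) := fun Q =>
    (Q.1.restrictScalars K).comap (homogeneousSubmodule σ K 1).subtype
  -- Over an infinite field, finitely many proper subspaces do not cover the space of linear forms.
  by_cases hcov : (⋃ Q, (p Q : Set (homogeneousSubmodule σ K 1))) = Set.univ
  · obtain ⟨Q, hQ⟩ := Subspace.exists_eq_top_of_iUnion_eq_univ hcov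
    refine absurd (Ideal.span_le.mpr ?_) (hne Q.1 Q.2)
    rintro _ ⟨i, rfl⟩
    have : (⟨X i, isHomogeneous_X K i⟩ : homogeneousSubmodule σ K 1) ∈ p Q :=
      hQ ▸ Submodule.mem_top
    exact this
  · obtain ⟨u, hu⟩ := (Set.ne_univ_iff_exists_notMem _).mp hcov
    refine ⟨u.1, u.2, fun Q hQ hmem => hu (Set.mem_iUnion.mpr ⟨⟨Q, hQ⟩, hmem⟩)⟩

variable [Finite σ]

/-- A linear form outside the relevant minimal primes lowers a positive dimension by one. Once the
dimension is at most zero, the only possible minimal prime is the irrelevant ideal. -/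
theorem MvPolynomial.exists_linear_forms_le_radical [Infinite K] (t : ℕ)
    (J : Ideal (MvPolynomial σ K)) (hJ : J.IsHomogeneous (homogeneousSubmodule σ K))
    (ht : ringKrullDim (MvPolynomial σ K ⧸ J) ≤ t) :
    ∃ u : Fin t → MvPolynomial σ K, (∀ i, (u i).IsHomogeneous 1) ∧
      idealOfVars σ K ≤ (J ⊔ Ideal.span (Set.range u)).radical := by
  induction t generalizing J with
  | zero =>
    refine ⟨Fin.elim0, fun i => i.elim0, ?_⟩
    refine le_trans ?_ (Ideal.radical_mono le_sup_left)
    rw [← Ideal.sInf_minimalPrimes]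
    refine le_sInf fun Q hQ => ?_
    have hQp := hQ.1.1
    have hle := (Ideal.isHomogeneous_of_mem_minimalPrimes hJ hQ).le_idealOfVars hQp.ne_top
    refine (Ideal.eq_of_le_of_ringKrullDim_le hle
      ((ringKrullDim_quotient_le_of_le hQ.1.2).trans ht) ?_).ge
    have : Nontrivial (MvPolynomial σ K ⧸ idealOfVars σ K) :=
      Ideal.Quotient.nontrivial_iff.mpr isMaximal_idealOfVars.ne_top
    exact ringKrullDim_nonneg_of_nontrivial
  | succ t ih =>
    obtain ⟨u₀, hu₀, hu₀Q⟩ := exists_linear_form_notMem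
      {Q | Q ∈ J.minimalPrimes ∧ ¬ idealOfVars σ K ≤ Q}
      (J.finite_minimalPrimes_of_isNoetherianRing.subset fun Q hQ => hQ.1) fun Q hQ => hQ.2
    obtain ⟨u, hu, hrad⟩ := ih (J ⊔ Ideal.span {u₀})
      (hJ.sup (Ideal.homogeneous_span _ _ (by rintro _ rfl; exact ⟨1, hu₀⟩))) (by
        by_contra hc
        have hc' : ((t + 1 : ℕ) : WithBot ℕ∞) ≤
            ringKrullDim (MvPolynomial σ K ⧸ (J ⊔ Ideal.span {u₀})) := by
          by_contra hc2
          exact hc (by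
            rw [not_le] at hc2
            revert hc2
            cases ringKrullDim (MvPolynomial σ K ⧸ (J ⊔ Ideal.span {u₀})) with
            | bot => simp
            | coe a =>
              intro h
              have h' : a < (t + 1 : ℕ) := by exact_mod_cast h
              have : a ≤ t := Order.le_of_lt_add_one (by exact_mod_cast h')
              exact_mod_cast this)
        obtain ⟨P, hP, hPd⟩ := exists_minimalPrimes_le_ringKrullDim hc'
        have hPp := hP.1.1
        obtain ⟨Q, hQ, hQP⟩ := Ideal.exists_minimalPrimes_le (le_sup_left.trans hP.1.2)
        have hQp := hQ.1.1
        by_cases hm : idealOfVars σ K ≤ Q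
        · have := hPd.trans ((ringKrullDim_quotient_le_of_le hQP).trans
            (ringKrullDim_quotient_le_zero hm))
          norm_cast at this
        -- A prime of dimension `t + 1` over the enlarged ideal would have to be a minimal prime of
        -- `J`, which `u₀` avoids.
        · have hQP' : Q = P := Ideal.eq_of_le_of_ringKrullDim_le hQP
            ((ringKrullDim_quotient_le_of_le hQ.1.2).trans ht) hPd
          refine hu₀Q Q ⟨hQ, hm⟩ (hQP' ▸ hP.1.2 ?_)
          exact Ideal.mem_sup_right (Ideal.mem_span_singleton_self u₀))
    refine ⟨Fin.cons u₀ u, fun i => Fin.cases hu₀ hu i, ?_⟩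
    rwa [Fin.range_cons, Ideal.span_insert, ← sup_assoc]

/-- Dividing out `c` forms of positive degree lowers the dimension of a graded quotient of a
polynomial ring by at most `c`. -/
theorem MvPolynomial.ringKrullDim_le_of_sup_span_le [Infinite K] {ι : Type*} [Fintype ι]
    {J : Ideal (MvPolynomial σ K)} (hJ : J.IsHomogeneous (homogeneousSubmodule σ K))
    (e : ι → MvPolynomial σ K) (m : ι → ℕ) (he : ∀ i, (e i).IsHomogeneous (m i))
    (hm : ∀ i, 0 < m i) {t : ℕ}
    (ht : ringKrullDim (MvPolynomial σ K ⧸ (J ⊔ Ideal.span (Set.range e))) ≤ t) :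
    ringKrullDim (MvPolynomial σ K ⧸ J) ≤ (t + Fintype.card ι : ℕ) := by
  -- The `t` linear forms finish the work of the `e i`: together they cut the locus of `J` down to
  -- the vertex, which bounds its dimension by their number.
  obtain ⟨u, hu, hrad⟩ := exists_linear_forms_le_radical t _
    (hJ.sup (Ideal.isHomogeneous_span_range he)) ht
  have := ringKrullDim_le_card_of_le_radical hJ (Sum.elim u e) (Sum.elim (fun _ => 1) m)
    (by rintro (i | i) <;> simp [hu, he]) (by rintro (i | i) <;> simp [hm]) (by
      rwa [Set.Sum.elim_range, Ideal.span_union, sup_comm (Ideal.span (Set.range u)), ← sup_assoc])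
  simpa using this

end Field

/-! ### Unmixedness of graded complete intersections -/

section Unmixed

variable {K : Type*} [Field K] {n : ℕ}

/-- Forms of positive degree cutting out the expected dimension form a regular sequence. -/
theorem MvPolynomial.isWeaklyRegular_of_isHomogeneous [Infinite K]
    (as : List (MvPolynomial (Fin n) K)) (has : ∀ a ∈ as, ∃ m, 0 < m ∧ a.IsHomogeneous m)
    (hlen : as.length ≤ n)
    (hd : ringKrullDim (MvPolynomial (Fin n) K ⧸ Ideal.ofList as) ≤ (n - as.length : ℕ)) :
    RingTheory.Sequence.IsWeaklyRegular (MvPolynomial (Fin n) K) as := by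
  induction as using List.reverseRecOn with
  | nil => exact RingTheory.Sequence.IsWeaklyRegular.nil _ _
  | append_singleton as b ih =>
    have hlen' : as.length + 1 ≤ n := by simpa using hlen
    obtain ⟨m, hm, hb⟩ := has b (by simp)
    have has' : ∀ a ∈ as, ∃ m, 0 < m ∧ a.IsHomogeneous m := fun a ha => has a (by simp [ha])
    have hhom : (Ideal.ofList as).IsHomogeneous (homogeneousSubmodule (Fin n) K) :=
      Ideal.homogeneous_span _ _ fun a ha => let ⟨m, _, h⟩ := has' a ha; ⟨m, h⟩
    rw [Ideal.ofList_append, Ideal.ofList_singleton] at hd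
    have hd' := ringKrullDim_le_of_sup_span_le hhom (fun _ : Unit => b) (fun _ => m)
      (fun _ => hb) (fun _ => hm) (by rwa [Set.range_const])
    have hreg := ih has' (by omega) (hd'.trans (by
      simp only [List.length_append, List.length_singleton, Fintype.card_unit]
      norm_cast
      omega))
    rw [RingTheory.Sequence.isWeaklyRegular_append_iff]
    refine ⟨hreg, ?_⟩
    rw [RingTheory.Sequence.isWeaklyRegular_singleton_iff,
      isSMulRegular_quotient_iff_mem_of_smul_mem]
    simp only [smul_eq_mul, Ideal.mul_top]
    intro f hf
    by_contra hfn
    -- If `b * f` lies in `(as)` but `f` does not, the annihilator of `f` modulo `as` contains both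
    -- `as` and `b`. Its dimension is then too small for unmixedness of `(as)`.
    refine lt_ringKrullDim_add_of_mul_mem hreg (J := Submodule.colon (Ideal.ofList as) {f})
      (fun a ha => ?_) hfn (fun a ha => by simpa [Submodule.mem_colon_singleton] using ha) ?_
    · exact Submodule.mem_colon_singleton.mpr (Ideal.mul_mem_right _ _ (Ideal.subset_span ha))
    · have hle : Ideal.ofList as ⊔ Ideal.span {b} ≤ Submodule.colon (Ideal.ofList as) {f} := by
        refine sup_le (fun a ha => Submodule.mem_colon_singleton.mpr
          (Ideal.mul_mem_right _ _ ha)) ?_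
        rw [Ideal.span_le, Set.singleton_subset_iff]
        exact Submodule.mem_colon_singleton.mpr hf
      calc _ ≤ ((n - (as ++ [b]).length : ℕ) : WithBot ℕ∞) + (as.length + 1 : ℕ) :=
            add_le_add_left ((ringKrullDim_quotient_le_of_le hle).trans hd) _
        _ ≤ n := by
          simp only [List.length_append, List.length_singleton]
          norm_cast
          omega

/-- A minimal prime is associated, hence the annihilator of some `f` modulo `as`, and unmixedness
applies to it. -/
theorem MvPolynomial.le_ringKrullDim_of_mem_minimalPrimes
    {as : List (MvPolynomial (Fin n) K)}
    (hreg : RingTheory.Sequence.IsWeaklyRegular (MvPolynomial (Fin n) K) as)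
    {Q : Ideal (MvPolynomial (Fin n) K)} (hQ : Q ∈ (Ideal.ofList as).minimalPrimes) :
    ¬ (ringKrullDim (MvPolynomial (Fin n) K ⧸ Q) + (as.length + 1 : ℕ) ≤ n) := by
  have hass := Module.associatedPrimes.minimalPrimes_annihilator_subset_associatedPrimes
    (MvPolynomial (Fin n) K) (MvPolynomial (Fin n) K ⧸ Ideal.ofList as)
    (by rwa [Ideal.annihilator_quotient] : Q ∈ _)
  obtain ⟨hp, x, hx⟩ := isAssociatedPrime_iff.mp hass
  obtain ⟨f, rfl⟩ := Ideal.Quotient.mk_surjective x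
  have hQf : ∀ a, a ∈ Q ↔ a * f ∈ Ideal.ofList as := by
    intro a
    rw [hx, Submodule.mem_colon_singleton, Submodule.mem_bot, ← Ideal.Quotient.eq_zero_iff_mem]
    rfl
  refine lt_ringKrullDim_add_of_mul_mem hreg (fun a ha => hQ.1.2 (Ideal.subset_span ha))
    (f := f) (fun hf => hp.ne_top ((Ideal.eq_top_iff_one _).mpr ((hQf 1).mpr (by simpa))))
    fun a ha => (hQf a).mp ha

end Unmixed

/-! ### Jacobian criterion -/

section LinearAlgebra

variable {K : Type*} [Field K] {c n : ℕ}

/-- Multiplying the Jacobian matrix by a fixed right inverse `B` of its value at a point encodes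
independence in one determinant, with no choice of minor. -/
theorem LinearIndependent.exists_mul_eq_one {v : Fin c → Fin n → K} (hv : LinearIndependent K v) :
    ∃ B : Matrix (Fin n) (Fin c) K, Matrix.of v * B = 1 := by
  obtain ⟨g, hg⟩ := LinearMap.exists_leftInverse_of_injective (Fintype.linearCombination K v)
    (LinearMap.ker_eq_bot'.mpr fun g hg => funext (Fintype.linearIndependent_iff.mp hv g
      (by simpa [Fintype.linearCombination_apply] using hg)))
  refine ⟨(LinearMap.toMatrix' g).transpose, ?_⟩
  ext j j'
  have h1 : g (v j) = Pi.single j 1 := by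
    have := LinearMap.congr_fun hg (Pi.single j 1)
    simpa [Fintype.linearCombination_apply_single] using this
  have h2 : (LinearMap.toMatrix' g).mulVec (v j) = g (v j) := LinearMap.toMatrix'_mulVec g (v j)
  rw [h1] at h2
  have h3 := congrFun h2 j'
  simp only [Matrix.mulVec, dotProduct] at h3
  simp only [Matrix.mul_apply, Matrix.of_apply, Matrix.transpose_apply]
  rw [Matrix.one_apply, ← Finset.sum_congr rfl fun i _ => mul_comm _ _, h3, Pi.single_apply]
  simp [eq_comm]

theorem linearIndependent_of_det_mul_ne_zero {v : Fin c → Fin n → K}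
    (B : Matrix (Fin n) (Fin c) K) (h : (Matrix.of v * B).det ≠ 0) : LinearIndependent K v := by
  have h1 := Matrix.linearIndependent_rows_of_det_ne_zero h
  refine LinearIndependent.of_comp B.vecMulLinear ?_
  exact h1

end LinearAlgebra

section Jacobian

variable {K : Type*} [Field K] {c n : ℕ}

/-- The Jacobian matrix of a finite family of polynomials. -/
def MvPolynomial.jacobian (h : Fin c → MvPolynomial (Fin n) K) :
    Matrix (Fin c) (Fin n) (MvPolynomial (Fin n) K) :=
  Matrix.of fun j i => pderiv i (h j)

/-- A scalar matrix as a matrix of constant polynomials. -/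
def MvPolynomial.constMatrix (B : Matrix (Fin n) (Fin c) K) :
    Matrix (Fin n) (Fin c) (MvPolynomial (Fin n) K) :=
  Matrix.of fun i j => C (B i j)

theorem MvPolynomial.eval_det_jacobian_mul (h : Fin c → MvPolynomial (Fin n) K) (v : Fin n → K)
    (B : Matrix (Fin n) (Fin c) K) : eval v (jacobian h * constMatrix B).det =
      (Matrix.of (fun j i => eval v (pderiv i (h j))) * B).det := by
  rw [RingHom.map_det]
  congr 1
  ext i j
  simp [Matrix.mul_apply, jacobian, constMatrix]

variable {h : Fin c → MvPolynomial (Fin n) K} {Q : Ideal (MvPolynomial (Fin n) K)} [Q.IsPrime]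

/-- The determinant of the Jacobian times `B` takes the value 1 at `v`, so it is not in `Q`.
Cramer's rule puts its product with each `b j` into `Q`. -/
theorem MvPolynomial.mem_of_sum_mul_pderiv_mem {v : Fin n → K} (hv : ∀ f ∈ Q, eval v f = 0)
    (hlin : LinearIndependent K (fun j i => eval v (pderiv i (h j))))
    (b : Fin c → MvPolynomial (Fin n) K) (hb : ∀ i, ∑ j, b j * pderiv i (h j) ∈ Q) (j : Fin c) :
    b j ∈ Q := by
  obtain ⟨B, hB⟩ := hlin.exists_mul_eq_one
  set N := jacobian h * constMatrix B with hN
  have hdet : N.det ∉ Q := by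
    intro hmem
    have := hv _ hmem
    rw [hN, eval_det_jacobian_mul, hB, Matrix.det_one] at this
    exact one_ne_zero this
  have h1 : ∀ i, Matrix.vecMul b (jacobian h) i ∈ Q := fun i => by
    simpa [Matrix.vecMul, dotProduct, jacobian] using hb i
  have h2 : Matrix.vecMul (Matrix.vecMul b (jacobian h)) (constMatrix B * N.adjugate) = N.det • b := by
    rw [Matrix.vecMul_vecMul, ← Matrix.mul_assoc, ← hN, Matrix.mul_adjugate, Matrix.vecMul_smul,
      Matrix.vecMul_one]
  have h3 : N.det * b j ∈ Q := by
    have := congrFun h2 j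
    rw [Pi.smul_apply, smul_eq_mul] at this
    rw [← this]
    change ∑ i, Matrix.vecMul b (jacobian h) i * (constMatrix B * N.adjugate) i j ∈ Q
    exact Q.sum_mem fun i _ => Q.mul_mem_right _ (h1 i)
  exact (Ideal.IsPrime.mem_or_mem ‹_› h3).resolve_left hdet

theorem MvPolynomial.pderiv_mem_of_mem_sq {I : Ideal (MvPolynomial (Fin n) K)}
    {f : MvPolynomial (Fin n) K} (hf : f ∈ I ^ 2) (i : Fin n) : pderiv i f ∈ I := by
  rw [pow_two] at hf
  refine Submodule.mul_induction_on hf (fun a ha b hb => ?_) fun a b ha hb => ?_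
  · rw [Derivation.leibniz]
    exact I.add_mem (I.mul_mem_right _ ha) (I.mul_mem_right _ hb)
  · rw [map_add]
    exact I.add_mem ha hb

open IsLocalRing in
-- After clearing denominators, a relation says that some `s * ∑ j, b j * h j` with `s ∉ Q` lies in
-- `Q ^ 2`. Differentiating gives a relation modulo `Q` between the gradients, so every `b j` lies
-- in `Q`.
theorem MvPolynomial.linearIndependent_toCotangent (hQ : ∀ j, h j ∈ Q)
    {v : Fin n → K} (hv : ∀ f ∈ Q, eval v f = 0)
    (hlin : LinearIndependent K (fun j i => eval v (pderiv i (h j))))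
    (x : Fin c → maximalIdeal (Localization.AtPrime Q))
    (hx : ∀ j, (x j : Localization.AtPrime Q) = algebraMap _ _ (h j)) :
    LinearIndependent (ResidueField (Localization.AtPrime Q))
      (fun j => (maximalIdeal (Localization.AtPrime Q)).toCotangent (x j)) := by
  rw [Fintype.linearIndependent_iff]
  intro g hg
  choose a ha using fun j => residue_surjective (g j)
  obtain ⟨t, ht⟩ := IsLocalization.exist_integer_multiples_of_finite Q.primeCompl a
  choose b hb using ht
  have hsum : ∑ j, a j * algebraMap _ (Localization.AtPrime Q) (h j) ∈
      maximalIdeal (Localization.AtPrime Q) ^ 2 := by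
    have h0 : (maximalIdeal (Localization.AtPrime Q)).toCotangent (∑ j, a j • x j) = 0 := by
      rw [← hg, map_sum]
      refine Finset.sum_congr rfl fun j _ => ?_
      rw [map_smul, ← ha]
      rfl
    rw [Ideal.toCotangent_eq_zero] at h0
    simpa [hx] using h0
  have hsum2 : algebraMap _ (Localization.AtPrime Q) (∑ j, b j * h j) ∈
      (Q ^ 2).map (algebraMap _ (Localization.AtPrime Q)) := by
    rw [Ideal.map_pow, Localization.AtPrime.map_eq_maximalIdeal, map_sum]
    have := (maximalIdeal (Localization.AtPrime Q) ^ 2).mul_mem_left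
      (algebraMap _ (Localization.AtPrime Q) (t : MvPolynomial (Fin n) K)) hsum
    rw [Finset.mul_sum] at this
    convert this using 2 with j
    rw [map_mul, hb, Algebra.smul_def, mul_assoc]
  obtain ⟨s, hs, hsQ⟩ := (IsLocalization.algebraMap_mem_map_algebraMap_iff Q.primeCompl _ _ _).mp
    hsum2
  have hbQ : ∀ j, b j ∈ Q := by
    refine mem_of_sum_mul_pderiv_mem hv hlin b fun i => ?_
    have h1 := pderiv_mem_of_mem_sq hsQ i
    have hbh : ∑ j, b j * h j ∈ Q := Q.sum_mem fun j _ => Q.mul_mem_left _ (hQ j)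
    rw [Derivation.leibniz, smul_eq_mul, smul_eq_mul] at h1
    have h2 := (Q.add_mem_iff_left (Q.mul_mem_right _ hbh)).mp h1
    have h3 := (Ideal.IsPrime.mem_or_mem ‹_› h2).resolve_left hs
    rw [map_sum] at h3
    simp only [Derivation.leibniz, smul_eq_mul, Finset.sum_add_distrib] at h3
    exact (Q.add_mem_iff_left (Q.sum_mem fun j _ => Q.mul_mem_right _ (hQ j))).mp h3
  intro j
  rw [← ha, residue_eq_zero_iff]
  have h4 : algebraMap _ (Localization.AtPrime Q) (b j) ∈
      maximalIdeal (Localization.AtPrime Q) := by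
    rw [← Localization.AtPrime.map_eq_maximalIdeal]
    exact Ideal.mem_map_of_mem _ (hbQ j)
  rw [hb, Algebra.smul_def] at h4
  refine (Ideal.IsPrime.mem_or_mem inferInstance h4).resolve_left fun h5 => ?_
  exact (mem_maximalIdeal _).mp h5 (IsLocalization.map_units _ t)

open IsLocalRing in
/-- Jacobian criterion: `c` polynomials whose differentials are independent at some point of a
component of codimension at most `c` of their zero locus generate its ideal generically. -/
theorem MvPolynomial.exists_notMem_mul_mem_span (hQ : Q ∈ (Ideal.span (Set.range h)).minimalPrimes)
    {v : Fin n → K} (hv : ∀ f ∈ Q, eval v f = 0)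
    (hlin : LinearIndependent K (fun j i => eval v (pderiv i (h j))))
    {f : MvPolynomial (Fin n) K} (hf : f ∈ Q) :
    ∃ s ∉ Q, s * f ∈ Ideal.span (Set.range h) := by
  have hhQ : ∀ j, h j ∈ Q := fun j => hQ.1.2 (Ideal.subset_span ⟨j, rfl⟩)
  let x : Fin c → maximalIdeal (Localization.AtPrime Q) := fun j =>
    ⟨algebraMap _ _ (h j), by
      rw [← Localization.AtPrime.map_eq_maximalIdeal]
      exact Ideal.mem_map_of_mem _ (hhQ j)⟩
  have hli := linearIndependent_toCotangent hhQ hv hlin x fun _ => rfl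
  have hht : Q.height ≤ c := by
    refine (Ideal.height_le_card_of_mem_minimalPrimes_span (Set.finite_range h) hQ).trans ?_
    have := Finite.card_range_le h
    rw [Nat.card_fin] at this
    exact Nat.cast_le.mpr this
  -- By regularity the cotangent space has dimension equal to the height of `Q`, at most `c`. So the
  -- `c` independent classes span it, and Nakayama shows that the `h j` generate the maximal ideal.
  have hreg : IsRegularLocalRing (Localization.AtPrime Q) := inferInstance
  have hfin : Module.finrank (ResidueField (Localization.AtPrime Q))
      (CotangentSpace (Localization.AtPrime Q)) ≤ c := by
    have h1 := (IsRegularLocalRing.iff_finrank_cotangentSpace _).mp hreg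
    rw [IsLocalization.AtPrime.ringKrullDim_eq_height Q] at h1
    have h2 : ((Module.finrank (ResidueField (Localization.AtPrime Q))
      (CotangentSpace (Localization.AtPrime Q)) : ℕ∞) : WithBot ℕ∞) = Q.height := h1
    rw [WithBot.coe_inj] at h2
    exact_mod_cast h2.trans_le hht
  have hspan := hli.span_eq_top_of_card_eq_finrank' (le_antisymm hli.fintype_card_le_finrank
    (by simpa using hfin))
  have hspan2 : Submodule.span (Localization.AtPrime Q) (Set.range x) = ⊤ := by
    rw [← CotangentSpace.span_image_eq_top_iff, ← hspan, ← Set.range_comp]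
    rfl
  have hmax : maximalIdeal (Localization.AtPrime Q) =
      (Ideal.span (Set.range h)).map (algebraMap _ (Localization.AtPrime Q)) := by
    have := congrArg (Submodule.map (maximalIdeal (Localization.AtPrime Q)).subtype) hspan2
    rw [Submodule.map_top, Submodule.range_subtype, Submodule.map_span, ← Set.range_comp] at this
    rw [Ideal.map_span, ← Set.range_comp, ← this]
    rfl
  have hfm : algebraMap _ (Localization.AtPrime Q) f ∈ maximalIdeal (Localization.AtPrime Q) := by
    rw [← Localization.AtPrime.map_eq_maximalIdeal]
    exact Ideal.mem_map_of_mem _ hf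
  rw [hmax, IsLocalization.algebraMap_mem_map_algebraMap_iff Q.primeCompl] at hfm
  obtain ⟨s, hs, hsf⟩ := hfm
  exact ⟨s, hs, hsf⟩

end Jacobian

/-! ### Generically reduced complete intersections are reduced -/

section CompleteIntersection

theorem WithBot.natCast_sub_le_of_not_add_le {x : WithBot ℕ∞} {n c : ℕ}
    (h : ¬ (x + (c + 1 : ℕ) ≤ n)) : ((n - c : ℕ) : WithBot ℕ∞) ≤ x := by
  revert h
  cases x with
  | bot => simp
  | coe a =>
    cases a with
    | top => exact fun _ => WithBot.coe_le_coe.mpr le_top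
    | coe a =>
      intro h
      have h1 : ¬ (a + (c + 1) ≤ n) := fun h2 => h (by exact_mod_cast h2)
      exact WithBot.coe_le_coe.mpr (Nat.cast_le.mpr (by omega))

variable {K : Type*} [Field K] [Infinite K] {c n : ℕ} {h : Fin c → MvPolynomial (Fin n) K}

theorem MvPolynomial.isWeaklyRegular_ofFn {m : ℕ} (hm : 0 < m) (hh : ∀ j, (h j).IsHomogeneous m)
    (hc : c ≤ n)
    (hd : ringKrullDim (MvPolynomial (Fin n) K ⧸ Ideal.span (Set.range h)) ≤ (n - c : ℕ)) :
    RingTheory.Sequence.IsWeaklyRegular (MvPolynomial (Fin n) K) (List.ofFn h) := by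
  have hspan : Ideal.ofList (List.ofFn h) = Ideal.span (Set.range h) := by
    simp [Ideal.ofList, Set.range, List.mem_ofFn]
  refine isWeaklyRegular_of_isHomogeneous _ ?_ (by simpa) (by rwa [hspan, List.length_ofFn])
  intro a ha
  obtain ⟨j, rfl⟩ := (List.mem_ofFn' _ _).mp ha
  exact ⟨m, hm, hh j⟩

/-- A graded complete intersection is equidimensional. -/
theorem MvPolynomial.ringKrullDim_eq_of_mem_minimalPrimes {m : ℕ} (hm : 0 < m)
    (hh : ∀ j, (h j).IsHomogeneous m) (hc : c ≤ n)
    (hd : ringKrullDim (MvPolynomial (Fin n) K ⧸ Ideal.span (Set.range h)) ≤ (n - c : ℕ))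
    {Q : Ideal (MvPolynomial (Fin n) K)} (hQ : Q ∈ (Ideal.span (Set.range h)).minimalPrimes) :
    ringKrullDim (MvPolynomial (Fin n) K ⧸ Q) = (n - c : ℕ) := by
  refine le_antisymm ((ringKrullDim_quotient_le_of_le hQ.1.2).trans hd) ?_
  have hspan : Ideal.ofList (List.ofFn h) = Ideal.span (Set.range h) := by
    simp [Ideal.ofList, Set.range, List.mem_ofFn]
  have := le_ringKrullDim_of_mem_minimalPrimes (isWeaklyRegular_ofFn hm hh hc hd) (hspan ▸ hQ)
  rw [List.length_ofFn] at this
  exact WithBot.natCast_sub_le_of_not_add_le this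

/-- A generically reduced graded complete intersection is reduced. -/
theorem MvPolynomial.mem_span_of_forall_minimalPrimes {m : ℕ} (hm : 0 < m)
    (hh : ∀ j, (h j).IsHomogeneous m) (hc : c ≤ n)
    (hd : ringKrullDim (MvPolynomial (Fin n) K ⧸ Ideal.span (Set.range h)) ≤ (n - c : ℕ))
    (hgen : ∀ Q ∈ (Ideal.span (Set.range h)).minimalPrimes, ∃ v : Fin n → K,
      (∀ f ∈ Q, eval v f = 0) ∧ LinearIndependent K (fun j i => eval v (pderiv i (h j))))
    {f : MvPolynomial (Fin n) K} (hf : ∀ Q ∈ (Ideal.span (Set.range h)).minimalPrimes, f ∈ Q) :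
    f ∈ Ideal.span (Set.range h) := by
  by_contra hfn
  have hspan : Ideal.ofList (List.ofFn h) = Ideal.span (Set.range h) := by
    simp [Ideal.ofList, Set.range, List.mem_ofFn]
  set J := Submodule.colon (Ideal.span (Set.range h)) {f} with hJdef
  have hIJ : Ideal.span (Set.range h) ≤ J := fun a ha =>
    Submodule.mem_colon_singleton.mpr (Ideal.mul_mem_right _ _ ha)
  have hJ := lt_ringKrullDim_add_of_mul_mem (isWeaklyRegular_ofFn hm hh hc hd) (J := J) (f := f)
    (fun a ha => hIJ (hspan ▸ Ideal.subset_span ha)) (hspan ▸ hfn)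
    (fun a ha => by rw [hspan]; exact Submodule.mem_colon_singleton.mp ha)
  have hJd : ((n - c : ℕ) : WithBot ℕ∞) ≤ ringKrullDim (MvPolynomial (Fin n) K ⧸ J) := by
    rw [List.length_ofFn] at hJ
    exact WithBot.natCast_sub_le_of_not_add_le hJ
  -- By dimension, some minimal prime of the annihilator of `f` is a minimal prime `Q` of the ideal.
  -- Generic reducedness at `Q` yields an element outside `Q` that kills `f`.
  obtain ⟨P, hP, hPd⟩ := exists_minimalPrimes_le_ringKrullDim hJd
  have hPp := hP.1.1
  obtain ⟨Q, hQ, hQP⟩ := Ideal.exists_minimalPrimes_le (hIJ.trans hP.1.2)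
  have hQp := hQ.1.1
  have hQP' : Q = P := Ideal.eq_of_le_of_ringKrullDim_le hQP
    ((ringKrullDim_quotient_le_of_le hQ.1.2).trans hd) hPd
  obtain ⟨v, hv, hlin⟩ := hgen Q hQ
  obtain ⟨s, hs, hsf⟩ := exists_notMem_mul_mem_span hQ hv hlin (hf Q hQ)
  exact hs (hQP' ▸ hP.1.2 (Submodule.mem_colon_singleton.mpr hsf))

end CompleteIntersection

theorem MvPolynomial.IsHomogeneous.eval_smul {σ R : Type*} [CommSemiring R] {f : MvPolynomial σ R}
    {m : ℕ} (hf : f.IsHomogeneous m) (c : R) (v : σ → R) :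
    eval (c • v) f = c ^ m * eval v f := by
  rw [eval_eq, eval_eq, Finset.mul_sum]
  refine Finset.sum_congr rfl fun s hs => ?_
  have hs' : ∑ i ∈ s.support, s i = m := by
    have := hf (mem_support_iff.mp hs)
    rwa [Finsupp.weight_apply, Finsupp.sum, Finset.sum_congr rfl (g := fun i => s i)] at this
    intro i _
    simp
  simp only [Pi.smul_apply, smul_eq_mul, mul_pow, Finset.prod_mul_distrib, Finset.prod_pow_eq_pow_sum,
    hs']
  ring

/-! ### Dictionary between projective sets and homogeneous ideals -/

namespace ProjAlg

variable {n : ℕ} {K : Type*} [Field K]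

theorem exists_eval_eq_pow_mul (v : Fin (n + 1) → K) (hv : v ≠ 0) :
    ∃ a : K, a ≠ 0 ∧ ∀ (f : MvPolynomial (Fin (n + 1)) K) (m : ℕ), f.IsHomogeneous m →
      eval (Projectivization.mk K v hv).rep f = a ^ m * eval v f := by
  obtain ⟨a, ha⟩ := Projectivization.exists_smul_eq_mk_rep K v hv
  refine ⟨a, a.ne_zero, fun f m hf => ?_⟩
  rw [← ha, ← hf.eval_smul]
  rfl

theorem eval_rep_mk_eq_zero_iff {f : MvPolynomial (Fin (n + 1)) K} {m : ℕ} (hf : f.IsHomogeneous m)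
    (v : Fin (n + 1) → K) (hv : v ≠ 0) :
    eval (Projectivization.mk K v hv).rep f = 0 ↔ eval v f = 0 := by
  obtain ⟨a, ha, h⟩ := exists_eval_eq_pow_mul v hv
  rw [h f m hf, mul_eq_zero, or_iff_right (pow_ne_zero _ ha)]

/-- The points of projective space at which all elements of an ideal vanish. -/
def projZero (J : Ideal (MvPolynomial (Fin (n + 1)) K)) : Set (ProjSpace n K) :=
  {x | ∀ f ∈ J, eval x.rep f = 0}

theorem projZero_anti {I J : Ideal (MvPolynomial (Fin (n + 1)) K)} (h : I ≤ J) :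
    projZero J ⊆ projZero I := fun _ hx f hf => hx f (h hf)

theorem eval_eq_zero_of_mem {J : Ideal (MvPolynomial (Fin (n + 1)) K)}
    (hJ : J.IsHomogeneous (homogeneousSubmodule (Fin (n + 1)) K)) {v w : Fin (n + 1) → K}
    (h : ∀ (f : MvPolynomial (Fin (n + 1)) K) (m : ℕ), f.IsHomogeneous m → eval w f = 0 →
      eval v f = 0) (hw : ∀ f ∈ J, eval w f = 0) : ∀ f ∈ J, eval v f = 0 := by
  intro f hf
  rw [← sum_homogeneousComponent f, map_sum]
  exact Finset.sum_eq_zero fun i _ => h _ i (homogeneousComponent_isHomogeneous i f)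
    (hw _ (homogeneousComponent_mem_of_mem hJ hf i))

theorem mk_mem_projZero {J : Ideal (MvPolynomial (Fin (n + 1)) K)}
    (hJ : J.IsHomogeneous (homogeneousSubmodule (Fin (n + 1)) K)) {v : Fin (n + 1) → K}
    (hv : v ≠ 0) : Projectivization.mk K v hv ∈ projZero J ↔ ∀ f ∈ J, eval v f = 0 :=
  ⟨eval_eq_zero_of_mem hJ fun _ _ hf => (eval_rep_mk_eq_zero_iff hf v hv).mp,
    eval_eq_zero_of_mem hJ fun _ _ hf => (eval_rep_mk_eq_zero_iff hf v hv).mpr⟩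

theorem rep_mem_cone {V : Set (ProjSpace n K)} {x : ProjSpace n K} (hx : x ∈ V) : x.rep ∈ cone V :=
  ⟨x.rep_nonzero, by rwa [x.mk_rep]⟩

theorem smul_mem_cone {V : Set (ProjSpace n K)} {v : Fin (n + 1) → K} (hv : v ∈ cone V) {c : K}
    (hc : c ≠ 0) : c • v ∈ cone V := by
  obtain ⟨h0, hv⟩ := hv
  refine ⟨smul_ne_zero hc h0, ?_⟩
  rwa [(Projectivization.mk_eq_mk_iff' K _ _ _ _).mpr ⟨c, rfl⟩]

theorem mem_zeroIdeal {V : Set (ProjSpace n K)} {f : MvPolynomial (Fin (n + 1)) K} :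
    f ∈ zeroIdeal V ↔ ∀ v ∈ cone V, eval v f = 0 := by
  simp [zeroIdeal, mem_vanishingIdeal_iff, aeval_eq_eval]

theorem zeroIdeal_anti {V Z : Set (ProjSpace n K)} (h : Z ⊆ V) : zeroIdeal V ≤ zeroIdeal Z :=
  vanishingIdeal_anti_mono fun _ ⟨h0, hv⟩ => ⟨h0, h hv⟩

theorem subset_projZero_zeroIdeal (V : Set (ProjSpace n K)) : V ⊆ projZero (zeroIdeal V) :=
  fun _ hx _ hf => mem_zeroIdeal.mp hf _ (rep_mem_cone hx)

theorem mem_zeroIdeal_iff_rep {V : Set (ProjSpace n K)} {f : MvPolynomial (Fin (n + 1)) K} {m : ℕ}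
    (hf : f.IsHomogeneous m) : f ∈ zeroIdeal V ↔ ∀ x ∈ V, eval x.rep f = 0 := by
  rw [mem_zeroIdeal]
  refine ⟨fun h x hx => h _ (rep_mem_cone hx), fun h v ⟨h0, hv⟩ => ?_⟩
  exact (eval_rep_mk_eq_zero_iff hf v h0).mp (h _ hv)

/-- For `v` in the cone, `f (c • v)` is a polynomial in `c` vanishing at all `c ≠ 0`; its
coefficients are the values at `v` of the homogeneous components of `f`. -/
theorem isHomogeneous_zeroIdeal [Infinite K] (V : Set (ProjSpace n K)) :
    (zeroIdeal V).IsHomogeneous (homogeneousSubmodule (Fin (n + 1)) K) := by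
  refine Ideal.isHomogeneous_of_homogeneousComponent_mem fun f hf e => ?_
  rw [mem_zeroIdeal] at hf ⊢
  intro v hv
  set p : Polynomial K := ∑ i ∈ Finset.range (f.totalDegree + 1),
    Polynomial.monomial i (eval v (homogeneousComponent i f)) with hp
  have hroot : ∀ c : K, c ≠ 0 → p.eval c = 0 := by
    intro c hc
    have := hf _ (smul_mem_cone hv hc)
    rw [← sum_homogeneousComponent f, map_sum] at this
    rw [hp, Polynomial.eval_finsetSum, ← this]
    refine Finset.sum_congr rfl fun i _ => ?_
    rw [(homogeneousComponent_isHomogeneous i f).eval_smul, Polynomial.eval_monomial, mul_comm]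
  have hp0 : p = 0 := by
    refine Polynomial.eq_zero_of_infinite_isRoot p
      ((Set.finite_singleton (0 : K)).infinite_compl.mono ?_)
    exact fun c hc => hroot c hc
  by_cases he : e < f.totalDegree + 1
  · have := congrArg (fun q => Polynomial.coeff q e) hp0
    simpa [hp, Polynomial.finsetSum_coeff, Polynomial.coeff_monomial, Finset.sum_ite_eq', he] using this
  · rw [homogeneousComponent_eq_zero _ _ (by omega), map_zero]

theorem exists_basic_open {U : Set (ProjSpace n K)} (hU : IsOpen U) {x : ProjSpace n K}
    (hx : x ∈ U) : ∃ (m : ℕ) (f : MvPolynomial (Fin (n + 1)) K), f.IsHomogeneous m ∧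
      eval x.rep f ≠ 0 ∧ {y : ProjSpace n K | eval y.rep f ≠ 0} ⊆ U := by
  induction hU with
  | basic s hs =>
    obtain ⟨m, f, hf, rfl⟩ := hs
    exact ⟨m, f, hf, hx, subset_rfl⟩
  | univ => exact ⟨0, 1, isHomogeneous_one _ _, by simp, Set.subset_univ _⟩
  | inter s t _ _ hs ht =>
    obtain ⟨m, f, hf, hfx, hfs⟩ := hs hx.1
    obtain ⟨m', g, hg, hgx, hgt⟩ := ht hx.2
    refine ⟨m + m', f * g, hf.mul hg, by simp [hfx, hgx], fun y hy => ?_⟩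
    rw [Set.mem_ofPred_eq, map_mul, mul_ne_zero_iff] at hy
    exact ⟨hfs hy.1, hgt hy.2⟩
  | sUnion s _ ih =>
    obtain ⟨t, ht, hxt⟩ := hx
    obtain ⟨m, f, hf, hfx, hft⟩ := ih t ht hxt
    exact ⟨m, f, hf, hfx, hft.trans (Set.subset_sUnion_of_mem ht)⟩

theorem isOpen_basic {f : MvPolynomial (Fin (n + 1)) K} {m : ℕ} (hf : f.IsHomogeneous m) :
    IsOpen {y : ProjSpace n K | eval y.rep f ≠ 0} :=
  TopologicalSpace.isOpen_generateFrom_of_mem ⟨m, f, hf, rfl⟩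

theorem isPrime_zeroIdeal [Infinite K] {Z : Set (ProjSpace n K)} (hZ : IsIrreducible Z) :
    (zeroIdeal Z).IsPrime := by
  refine (isHomogeneous_zeroIdeal Z).isPrime_of_homogeneous_mem_or_mem ?_ ?_
  · intro h
    obtain ⟨x, hx⟩ := hZ.1
    have := mem_zeroIdeal.mp ((Ideal.eq_top_iff_one _).mp h) _ (rep_mem_cone hx)
    simp at this
  · rintro f g ⟨m, hf⟩ ⟨m', hg⟩ hfg
    rw [mem_homogeneousSubmodule] at hf hg
    rw [mem_zeroIdeal_iff_rep hf, mem_zeroIdeal_iff_rep hg]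
    rw [mem_zeroIdeal_iff_rep (hf.mul hg)] at hfg
    by_contra! ⟨⟨x, hx, hfx⟩, y, hy, hgy⟩
    obtain ⟨z, hz, hzf, hzg⟩ :=
      hZ.2 _ _ (isOpen_basic hf) (isOpen_basic hg) ⟨x, hx, hfx⟩ ⟨y, hy, hgy⟩
    have := hfg z hz
    rw [map_mul, mul_eq_zero] at this
    exact this.elim hzf hzg

theorem not_idealOfVars_le_of_mem_projZero {J : Ideal (MvPolynomial (Fin (n + 1)) K)}
    {x : ProjSpace n K} (hx : x ∈ projZero J) : ¬ idealOfVars (Fin (n + 1)) K ≤ J := by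
  intro h
  refine x.rep_nonzero (funext fun i => ?_)
  have := hx _ (h (Ideal.subset_span (Set.mem_range_self i)))
  simpa using this

theorem le_zeroIdeal {J : Ideal (MvPolynomial (Fin (n + 1)) K)}
    (hJ : J.IsHomogeneous (homogeneousSubmodule (Fin (n + 1)) K)) {Y : Set (ProjSpace n K)}
    (hY : Y ⊆ projZero J) : J ≤ zeroIdeal Y :=
  fun f hf => mem_zeroIdeal.mpr fun _ ⟨h0, hv⟩ => (mk_mem_projZero hJ h0).mp (hY hv) f hf

section IsAlgClosed

variable [IsAlgClosed K]

theorem zeroIdeal_projZero {P : Ideal (MvPolynomial (Fin (n + 1)) K)} [P.IsPrime]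
    (hP : P.IsHomogeneous (homogeneousSubmodule (Fin (n + 1)) K))
    (hv : ¬ idealOfVars (Fin (n + 1)) K ≤ P) : zeroIdeal (projZero P) = P := by
  refine le_antisymm (fun f hf => ?_) fun f hf => mem_zeroIdeal.mpr fun v ⟨h0, hv⟩ => ?_
  · obtain ⟨i, hi⟩ : ∃ i, X i ∉ P := by
      by_contra! h
      exact hv (Ideal.span_le.mpr (Set.range_subset_iff.mpr h))
    -- The cone omits the origin, where `f` need not vanish. The factor `X i` vanishes there, so the
    -- Nullstellensatz applies to the product.
    refine (Ideal.IsPrime.mem_or_mem ‹_› (?_ : X i * f ∈ P)).resolve_left hi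
    rw [← IsPrime.vanishingIdeal_zeroLocus (K := K) P, mem_vanishingIdeal_iff]
    intro v hvP
    rw [map_mul, mul_eq_zero, aeval_X]
    by_cases h0 : v = 0
    · simp [h0]
    · rw [mem_zeroIdeal] at hf
      right
      rw [aeval_eq_eval]
      refine hf v ⟨h0, (mk_mem_projZero hP h0).mpr fun g hg => ?_⟩
      simpa [aeval_eq_eval] using hvP g hg
  · exact (mk_mem_projZero hP h0).mp hv f hf

theorem projZero_nonempty {P : Ideal (MvPolynomial (Fin (n + 1)) K)} [P.IsPrime]
    (hP : P.IsHomogeneous (homogeneousSubmodule (Fin (n + 1)) K))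
    (hv : ¬ idealOfVars (Fin (n + 1)) K ≤ P) : (projZero P).Nonempty := by
  rw [Set.nonempty_iff_ne_empty]
  intro h
  have h1 := zeroIdeal_projZero hP hv
  rw [h] at h1
  refine Ideal.IsPrime.ne_top ‹_› (h1 ▸ (Ideal.eq_top_iff_one _).mpr (mem_zeroIdeal.mpr ?_))
  rintro v ⟨_, hv⟩
  exact absurd hv (Set.notMem_empty _)

theorem isIrreducible_projZero {P : Ideal (MvPolynomial (Fin (n + 1)) K)} [P.IsPrime]
    (hP : P.IsHomogeneous (homogeneousSubmodule (Fin (n + 1)) K))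
    (hv : ¬ idealOfVars (Fin (n + 1)) K ≤ P) : IsIrreducible (projZero P) := by
  refine ⟨projZero_nonempty hP hv, ?_⟩
  rintro U U' hU hU' ⟨x, hx, hxU⟩ ⟨y, hy, hyU⟩
  obtain ⟨m, f, hf, hfx, hfU⟩ := exists_basic_open hU hxU
  obtain ⟨m', g, hg, hgy, hgU⟩ := exists_basic_open hU' hyU
  by_contra hcon
  have : f * g ∈ P := by
    rw [← zeroIdeal_projZero hP hv, mem_zeroIdeal_iff_rep (hf.mul hg)]
    intro z hz
    by_contra hz0
    rw [map_mul, mul_eq_zero, not_or] at hz0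
    exact hcon ⟨z, hz, hfU hz0.1, hgU hz0.2⟩
  rcases Ideal.IsPrime.mem_or_mem ‹_› this with h | h
  · exact hfx (hx f h)
  · exact hgy (hy g h)

theorem isComponent_projZero {J Q : Ideal (MvPolynomial (Fin (n + 1)) K)}
    (hJ : J.IsHomogeneous (homogeneousSubmodule (Fin (n + 1)) K)) (hQ : Q ∈ J.minimalPrimes)
    (hv : ¬ idealOfVars (Fin (n + 1)) K ≤ Q) : IsComponent (projZero J) (projZero Q) := by
  have := hQ.1.1
  have hQh := Ideal.isHomogeneous_of_mem_minimalPrimes hJ hQ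
  refine ⟨⟨isIrreducible_projZero hQh hv, projZero_anti hQ.1.2⟩, ?_⟩
  rintro Y ⟨hY, hYJ⟩ hle y hy f hf
  have hp := isPrime_zeroIdeal hY
  have h1 : zeroIdeal Y ≤ Q := (zeroIdeal_anti hle).trans (zeroIdeal_projZero hQh hv).le
  exact subset_projZero_zeroIdeal Y hy f (hQ.2 ⟨hp, le_zeroIdeal hJ hYJ⟩ h1 hf)

theorem exists_minimalPrimes_of_isIrreducible {J : Ideal (MvPolynomial (Fin (n + 1)) K)}
    (hJ : J.IsHomogeneous (homogeneousSubmodule (Fin (n + 1)) K)) {Y : Set (ProjSpace n K)}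
    (hY : IsIrreducible Y) (hYJ : Y ⊆ projZero J) :
    ∃ Q ∈ J.minimalPrimes, ¬ idealOfVars (Fin (n + 1)) K ≤ Q ∧ Y ⊆ projZero Q := by
  have := isPrime_zeroIdeal hY
  obtain ⟨Q, hQ, hQY⟩ := Ideal.exists_minimalPrimes_le (le_zeroIdeal hJ hYJ)
  have hsub : Y ⊆ projZero Q := (subset_projZero_zeroIdeal Y).trans (projZero_anti hQY)
  obtain ⟨y, hy⟩ := hY.1
  exact ⟨Q, hQ, not_idealOfVars_le_of_mem_projZero (hsub hy), hsub⟩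

theorem isComponent_iff {J : Ideal (MvPolynomial (Fin (n + 1)) K)}
    (hJ : J.IsHomogeneous (homogeneousSubmodule (Fin (n + 1)) K)) {Z : Set (ProjSpace n K)} :
    IsComponent (projZero J) Z ↔
      ∃ Q ∈ J.minimalPrimes, ¬ idealOfVars (Fin (n + 1)) K ≤ Q ∧ Z = projZero Q := by
  constructor
  · intro hZ
    obtain ⟨Q, hQ, hv, hsub⟩ := exists_minimalPrimes_of_isIrreducible hJ hZ.1.1 hZ.1.2
    exact ⟨Q, hQ, hv, hZ.eq_of_le (isComponent_projZero hJ hQ hv).1 hsub⟩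
  · rintro ⟨Q, hQ, hv, rfl⟩
    exact isComponent_projZero hJ hQ hv

theorem coneDim_projZero {J Q : Ideal (MvPolynomial (Fin (n + 1)) K)}
    (hJ : J.IsHomogeneous (homogeneousSubmodule (Fin (n + 1)) K)) (hQ : Q ∈ J.minimalPrimes)
    (hv : ¬ idealOfVars (Fin (n + 1)) K ≤ Q) :
    coneDim (projZero Q) = ringKrullDim (MvPolynomial (Fin (n + 1)) K ⧸ Q) := by
  have := hQ.1.1
  rw [coneDim, zeroIdeal_projZero (Ideal.isHomogeneous_of_mem_minimalPrimes hJ hQ) hv]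

/-- The condition on the minimal primes excludes the irrelevant ideal, whose locus is empty and has
the whole ring as zero ideal. -/
theorem mem_zeroIdeal_projZero_iff {J : Ideal (MvPolynomial (Fin (n + 1)) K)}
    (hJ : J.IsHomogeneous (homogeneousSubmodule (Fin (n + 1)) K))
    (hv : ∀ Q ∈ J.minimalPrimes, ¬ idealOfVars (Fin (n + 1)) K ≤ Q)
    {f : MvPolynomial (Fin (n + 1)) K} :
    f ∈ zeroIdeal (projZero J) ↔ ∀ Q ∈ J.minimalPrimes, f ∈ Q := by
  constructor
  · intro hf Q hQ
    have := hQ.1.1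
    rw [← zeroIdeal_projZero (Ideal.isHomogeneous_of_mem_minimalPrimes hJ hQ) (hv Q hQ)]
    exact zeroIdeal_anti (projZero_anti hQ.1.2) hf
  · intro h
    rw [mem_zeroIdeal]
    rintro v ⟨h0, hvJ⟩
    obtain ⟨Q, hQ, -, hsub⟩ := exists_minimalPrimes_of_isIrreducible hJ
      (isIrreducible_singleton (x := Projectivization.mk K v h0)) (Set.singleton_subset_iff.mpr hvJ)
    exact (mk_mem_projZero (Ideal.isHomogeneous_of_mem_minimalPrimes hJ hQ) h0).mp
      (hsub rfl) f (h Q hQ)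

end IsAlgClosed

end ProjAlg

theorem MvPolynomial.isHomogeneous_det_jacobian_mul {K : Type*} [Field K] {c n m : ℕ}
    {h : Fin c → MvPolynomial (Fin n) K} (hh : ∀ j, (h j).IsHomogeneous m)
    (B : Matrix (Fin n) (Fin c) K) :
    ((jacobian h * constMatrix B).det).IsHomogeneous (c * (m - 1)) := by
  rw [Matrix.det_apply]
  refine IsHomogeneous.sum _ _ _ fun s _ => ?_
  have hprod : (∏ i, (jacobian h * constMatrix B) (s i) i).IsHomogeneous (∑ _i : Fin c, (m - 1)) := by
    refine IsHomogeneous.prod _ _ _ fun i _ => ?_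
    rw [Matrix.mul_apply]
    refine IsHomogeneous.sum _ _ _ fun l _ => ?_
    simpa [jacobian, constMatrix] using ((hh (s i)).pderiv (i := l)).mul (isHomogeneous_C _ (B l i))
  rw [Finset.sum_const, Finset.card_univ, Fintype.card_fin, smul_eq_mul] at hprod
  rw [Units.smul_def, zsmul_eq_mul, ← map_intCast (C (R := K) (σ := Fin n))]
  simpa using (isHomogeneous_C (Fin n) ((s.sign : ℤ) : K)).mul hprod

/-- In the degree `m` part of `∑ j, a j * h j` only the constant terms of the `a j` survive. -/
theorem MvPolynomial.mem_submodule_span_of_mem_span {σ K ι : Type*} [Field K] [Finite ι]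
    {h : ι → MvPolynomial σ K} {m : ℕ} (hh : ∀ j, (h j).IsHomogeneous m) {f : MvPolynomial σ K}
    (hf : f.IsHomogeneous m) (hmem : f ∈ Ideal.span (Set.range h)) :
    f ∈ Submodule.span K (Set.range h) := by
  cases nonempty_fintype ι
  obtain ⟨a, rfl⟩ := Ideal.mem_span_range_iff_exists_fun.mp hmem
  rw [← (homogeneousComponent_of_mem hf).trans (if_pos rfl), map_sum]
  refine Submodule.sum_mem _ fun j _ => ?_
  rw [homogeneousComponent_mul_of_isHomogeneous (hh j), if_pos le_rfl, Nat.sub_self,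
    homogeneousComponent_zero, ← smul_eq_C_mul]
  exact Submodule.smul_mem _ _ (Submodule.subset_span ⟨j, rfl⟩)

/-- Independence of `φ ∘ h` makes `φ` injective on the span of `h`. -/
theorem LinearIndependent.of_mem_span_of_map {K E F ι κ : Type*} [Field K] [AddCommGroup E]
    [Module K E] [AddCommGroup F] [Module K F] (φ : E →ₗ[K] F) {h : ι → E} {g : κ → E}
    (hh : LinearIndependent K (φ ∘ h)) (hg : LinearIndependent K g)
    (hgh : ∀ i, g i ∈ Submodule.span K (Set.range h)) : LinearIndependent K (φ ∘ g) := by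
  refine hg.map ((Submodule.range_ker_disjoint hh).mono_left (Submodule.span_le.mpr ?_))
  rintro _ ⟨i, rfl⟩
  exact hgh i

theorem WithBot.add_natCast_eq_iff {x : WithBot ℕ∞} {n c : ℕ} (hc : c ≤ n) :
    x + (c : WithBot ℕ∞) = (n : ℕ) ↔ x = (n - c : ℕ) := by
  induction x using WithBot.recBotCoe with
  | bot =>
    simp only [WithBot.bot_add]
    exact ⟨fun h => absurd h (by exact WithBot.bot_ne_coe), fun h => absurd h (by exact WithBot.bot_ne_coe)⟩
  | coe a =>
    induction a using ENat.recTopCoe with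
    | top =>
      constructor
      · intro h
        have : (⊤ : ℕ∞) + (c : ℕ∞) = (n : ℕ) := WithBot.coe_injective h
        simp at this
      · intro h
        have : (⊤ : ℕ∞) = ((n - c : ℕ) : ℕ∞) := WithBot.coe_injective h
        exact absurd this.symm (ENat.natCast_ne_top _)
    | coe a =>
      constructor
      · intro h
        have : a + c = n := by exact_mod_cast h
        rw [← this, Nat.add_sub_cancel]
        rfl
      · intro h
        have : a = n - c := Nat.cast_injective (R := ℕ∞) (WithBot.coe_injective h)
        subst this
        have : n - c + c = n := by omega
        exact_mod_cast this

/-! ### Tangent spaces and smoothness of complete intersections -/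

namespace ProjAlg

section Scalars

variable {n : ℕ} {k K : Type*} [Field k] [Field K] [Algebra k K]

theorem gradientAt_map (f : MvPolynomial (Fin (n + 1)) k) (p : ProjSpace n K) :
    gradientAt (map (algebraMap k K) f) p = gradientAt f p := by
  funext i
  rw [gradientAt, gradientAt, pderiv_map, aeval_map_algebraMap]

theorem mem_hypersurface {f : MvPolynomial (Fin (n + 1)) k} {x : ProjSpace n K} :
    x ∈ hypersurface K f ↔ eval x.rep (map (algebraMap k K) f) = 0 := by
  rw [eval_map]
  rfl

theorem mem_projZero_span {s : Set (MvPolynomial (Fin (n + 1)) K)} {x : ProjSpace n K} :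
    x ∈ projZero (Ideal.span s) ↔ ∀ f ∈ s, eval x.rep f = 0 := by
  refine ⟨fun h f hf => h f (Ideal.subset_span hf), fun h f hf => ?_⟩
  exact (Ideal.span_le (I := RingHom.ker (eval x.rep))).mpr h hf

theorem iInter_hypersurface {ι : Type*} (h : ι → MvPolynomial (Fin (n + 1)) k) :
    ⋂ j, hypersurface K (h j) =
      projZero (Ideal.span (Set.range fun j => map (algebraMap k K) (h j))) := by
  ext x
  simp [mem_projZero_span, mem_hypersurface]

/-- The differential at a point, as a linear map on polynomials. -/
def gradientMap (p : ProjSpace n K) : MvPolynomial (Fin (n + 1)) K →ₗ[K] (Fin (n + 1) → K) :=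
  LinearMap.pi fun i => (aeval (R := K) p.rep).toLinearMap ∘ₗ (pderiv i).toLinearMap

end Scalars

section CompleteIntersection

variable {n c d : ℕ} {K : Type*} [Field K] {h : Fin c → MvPolynomial (Fin (n + 1)) K}

theorem gradientAt_eq (f : MvPolynomial (Fin (n + 1)) K) (p : ProjSpace n K) :
    gradientAt f p = fun i => eval p.rep (pderiv i f) := by
  funext i
  rw [gradientAt, aeval_eq_eval]

theorem exists_isOpen_linearIndependent (hh : ∀ j, (h j).IsHomogeneous d) {p : ProjSpace n K}
    (hp : LinearIndependent K fun j => gradientAt (h j) p) :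
    ∃ U : Set (ProjSpace n K), IsOpen U ∧ p ∈ U ∧
      ∀ x ∈ U, LinearIndependent K fun j => gradientAt (h j) x := by
  obtain ⟨B, hB⟩ := hp.exists_mul_eq_one
  refine ⟨_, isOpen_basic (isHomogeneous_det_jacobian_mul hh B), ?_, fun x hx => ?_⟩
  · rw [Set.mem_ofPred_eq, eval_det_jacobian_mul]
    simp only [gradientAt_eq] at hB
    rw [hB, Matrix.det_one]
    exact one_ne_zero
  · rw [Set.mem_ofPred_eq, eval_det_jacobian_mul] at hx
    simp only [gradientAt_eq]
    exact linearIndependent_of_det_mul_ne_zero B hx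

/-- By Leibniz, at a point where the generators vanish, the differential of a combination is a
combination of their differentials. -/
theorem coneTangentSpace_eq_ker {V : Set (ProjSpace n K)}
    (hV : zeroIdeal V = Ideal.span (Set.range h)) {p : ProjSpace n K} (hp : p ∈ V) :
    coneTangentSpace V p =
      LinearMap.ker (Matrix.mulVecLin (Matrix.of fun j => gradientAt (h j) p)) := by
  have hz : ∀ f ∈ zeroIdeal V, eval p.rep f = 0 := subset_projZero_zeroIdeal V hp
  ext w
  rw [LinearMap.mem_ker, Matrix.mulVecLin_apply]
  constructor
  · intro hw
    funext j
    exact hw (h j) (hV ▸ Ideal.subset_span ⟨j, rfl⟩)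
  · intro hw f hf
    rw [hV] at hf
    obtain ⟨a, rfl⟩ := Ideal.mem_span_range_iff_exists_fun.mp hf
    have h0 : ∀ j, eval p.rep (h j) = 0 := fun j => hz _ (hV ▸ Ideal.subset_span ⟨j, rfl⟩)
    have hj : ∀ j, ∑ i, eval p.rep (pderiv i (h j)) * w i = 0 := fun j => by
      have := congrFun hw j
      simpa [Matrix.mulVec, dotProduct, gradientAt_eq] using this
    simp only [gradientAt_eq, map_sum, Derivation.leibniz, map_add, smul_eq_mul, map_mul, h0,
      zero_mul, add_zero, Finset.sum_mul]
    rw [Finset.sum_comm]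
    refine Finset.sum_eq_zero fun j _ => ?_
    simp only [mul_assoc, ← Finset.mul_sum, hj, mul_zero]

theorem finrank_coneTangentSpace_eq_iff {V : Set (ProjSpace n K)} (hc : c ≤ n)
    (hV : zeroIdeal V = Ideal.span (Set.range h)) {p : ProjSpace n K} (hp : p ∈ V) :
    Module.finrank K (coneTangentSpace V p) = n + 1 - c ↔
      LinearIndependent K fun j => gradientAt (h j) p := by
  rw [coneTangentSpace_eq_ker hV hp, linearIndependent_iff_card_eq_finrank_span]
  have h1 := (Matrix.mulVecLin (Matrix.of fun j => gradientAt (h j) p)).finrank_range_add_finrank_ker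
  have h2 := (Matrix.of fun j => gradientAt (h j) p).rank_eq_finrank_span_row
  have h3 : (Matrix.of fun j => gradientAt (h j) p).row = fun j => gradientAt (h j) p := rfl
  rw [h3, Matrix.rank] at h2
  rw [Set.finrank, ← h2]
  rw [Module.finrank_fin_fun] at h1
  have h4 := (Matrix.of fun j => gradientAt (h j) p).rank_le_card_height
  rw [Matrix.rank] at h4
  simp only [Fintype.card_fin] at h4 ⊢
  omega

variable [IsAlgClosed K] (hd : 0 < d) (hh : ∀ j, (h j).IsHomogeneous d) (hc : c ≤ n)
  (hdim : ringKrullDim (MvPolynomial (Fin (n + 1)) K ⧸ Ideal.span (Set.range h)) ≤ (n + 1 - c : ℕ))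

include hd hh hc hdim

/-- As `c ≤ n`, every minimal prime has dimension `n + 1 - c ≥ 1`, while the vertex has dimension
zero. -/
theorem not_idealOfVars_le_of_mem_minimalPrimes {Q : Ideal (MvPolynomial (Fin (n + 1)) K)}
    (hQ : Q ∈ (Ideal.span (Set.range h)).minimalPrimes) : ¬ idealOfVars (Fin (n + 1)) K ≤ Q := by
  intro hle
  have h1 := ringKrullDim_eq_of_mem_minimalPrimes hd hh (by omega) hdim hQ
  have h2 := ringKrullDim_quotient_le_zero hle
  rw [h1] at h2
  have : n + 1 - c ≤ 0 := by exact_mod_cast h2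
  omega

theorem coneDim_eq_of_isComponent {Z : Set (ProjSpace n K)}
    (hZ : IsComponent (projZero (Ideal.span (Set.range h))) Z) : coneDim Z = (n + 1 - c : ℕ) := by
  have hJ := Ideal.isHomogeneous_span_range hh
  obtain ⟨Q, hQ, hv, rfl⟩ := (isComponent_iff hJ).mp hZ
  rw [coneDim_projZero hJ hQ hv]
  exact ringKrullDim_eq_of_mem_minimalPrimes hd hh (by omega) hdim hQ

theorem localConeDim_eq {p : ProjSpace n K} (hp : p ∈ projZero (Ideal.span (Set.range h))) :
    localConeDim (projZero (Ideal.span (Set.range h))) p = (n + 1 - c : ℕ) := by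
  have hJ := Ideal.isHomogeneous_span_range hh
  refine le_antisymm (iSup₂_le fun Z hZ => (coneDim_eq_of_isComponent hd hh hc hdim hZ.1).le) ?_
  obtain ⟨Q, hQ, hv, hsub⟩ := exists_minimalPrimes_of_isIrreducible hJ
    (isIrreducible_singleton (x := p)) (Set.singleton_subset_iff.mpr hp)
  have hZ := isComponent_projZero hJ hQ hv
  rw [← coneDim_eq_of_isComponent hd hh hc hdim hZ]
  exact le_iSup₂_of_le (projZero Q) ⟨hZ, hsub rfl⟩ le_rfl

theorem zeroIdeal_projZero_span
    (hgen : ∀ Z, IsComponent (projZero (Ideal.span (Set.range h))) Z →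
      ∃ x ∈ Z, LinearIndependent K fun j => gradientAt (h j) x) :
    zeroIdeal (projZero (Ideal.span (Set.range h))) = Ideal.span (Set.range h) := by
  have hJ := Ideal.isHomogeneous_span_range hh
  have hv := fun Q => not_idealOfVars_le_of_mem_minimalPrimes hd hh hc hdim (Q := Q)
  refine le_antisymm (fun f hf => ?_) (le_zeroIdeal hJ subset_rfl)
  refine mem_span_of_forall_minimalPrimes hd hh (by omega) hdim (fun Q hQ => ?_)
    ((mem_zeroIdeal_projZero_iff hJ fun Q hQ => hv Q hQ).mp hf)
  obtain ⟨x, hx, hlin⟩ := hgen _ (isComponent_projZero hJ hQ (hv Q hQ))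
  simp only [gradientAt_eq] at hlin
  exact ⟨x.rep, hx, hlin⟩

theorem isSmoothAt_iff
    (hgen : ∀ Z, IsComponent (projZero (Ideal.span (Set.range h))) Z →
      ∃ x ∈ Z, LinearIndependent K fun j => gradientAt (h j) x)
    {p : ProjSpace n K} (hp : p ∈ projZero (Ideal.span (Set.range h))) :
    IsSmoothAt (projZero (Ideal.span (Set.range h))) p ↔
      LinearIndependent K fun j => gradientAt (h j) p := by
  rw [IsSmoothAt, and_iff_right hp, localConeDim_eq hd hh hc hdim hp,
    ← finrank_coneTangentSpace_eq_iff hc (zeroIdeal_projZero_span hd hh hc hdim hgen) hp]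
  exact_mod_cast Iff.rfl

end CompleteIntersection

end ProjAlg

/-! ### Choice of equations and proof of the proposition -/

/-- The `g i` are a basis of the span of `s` taken from `s` itself, which keeps them among the given
equations over `k`; the `e i` complete them to a basis of the span of `h`. -/
theorem exists_linearIndependent_fin_of_subset_span {K E ι : Type*} [Field K] [AddCommGroup E]
    [Module K E] [Fintype ι] (h : ι → E) (s : Set E)
    (hs : s ⊆ Submodule.span K (Set.range h)) :
    ∃ (c a : ℕ) (g : Fin c → E) (e : Fin a → E), c + a ≤ Fintype.card ι ∧
      (∀ i, g i ∈ s) ∧ LinearIndependent K g ∧ s ⊆ Submodule.span K (Set.range g) ∧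
      (∀ i, e i ∈ Submodule.span K (Set.range h)) ∧
      ∀ j, h j ∈ Submodule.span K (Set.range g) ⊔ Submodule.span K (Set.range e) := by
  set H := Submodule.span K (Set.range h) with hH
  obtain ⟨b, hbs, hspan, hli⟩ := exists_linearIndependent K s
  obtain ⟨t, htH, hbt, hHt, hlit⟩ := exists_linearIndepOn_id_extension (s := b)
    (t := (H : Set E)) hli (hbs.trans hs)
  have hspant : Submodule.span K t = H := le_antisymm (Submodule.span_le.mpr htH) hHt
  have hfinH : Module.Finite K H := Module.Finite.span_of_finite K (Set.finite_range h)
  have hliH : LinearIndependent K (fun x : t => (⟨x, htH x.2⟩ : H)) :=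
    LinearIndependent.of_comp H.subtype hlit
  have htfin : Finite t := hliH.finite
  have hbfin : Finite b := Finite.Set.subset t hbt
  have hdfin : Finite (t \ b : Set E) := Finite.Set.subset t Set.sdiff_subset
  have hcard : Nat.card b + Nat.card (t \ b : Set E) ≤ Fintype.card ι := by
    cases nonempty_fintype t
    have h1 := hliH.fintype_card_le_finrank
    have h2 : Module.finrank K H ≤ Fintype.card ι := finrank_range_le_card h
    rw [add_comm, Nat.card_coe_set_eq, Nat.card_coe_set_eq, Set.ncard_sdiff_add_ncard_of_subset hbt,
      ← Nat.card_coe_set_eq, Nat.card_eq_fintype_card]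
    exact h1.trans h2
  have hg : Set.range (fun i => ((Finite.equivFin b).symm i : E)) = b := by
    rw [← Function.comp_def, EquivLike.range_comp, Subtype.range_coe]
  have he : Set.range (fun i => ((Finite.equivFin (t \ b : Set E)).symm i : E)) = t \ b := by
    rw [← Function.comp_def, EquivLike.range_comp, Subtype.range_coe]
  refine ⟨_, _, fun i => (Finite.equivFin b).symm i, fun i => (Finite.equivFin (t \ b : Set E)).symm i,
    hcard, fun i => hbs (Subtype.prop _), hli.comp _ (Equiv.injective _), ?_,
    fun i => htH (Subtype.prop ((Finite.equivFin (t \ b : Set E)).symm i)).1, fun j => ?_⟩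
  · rw [hg, hspan]
    exact Submodule.subset_span
  · rw [hg, he, ← Submodule.span_union, Set.union_sdiff_cancel hbt, hspant]
    exact Submodule.subset_span ⟨j, rfl⟩

namespace ProjAlg

theorem inter_nonempty_of_isComponent {n c a d r : ℕ} {K : Type*} [Field K] [IsAlgClosed K]
    {h : Fin r → MvPolynomial (Fin (n + 1)) K} {g : Fin c → MvPolynomial (Fin (n + 1)) K}
    {e : Fin a → MvPolynomial (Fin (n + 1)) K} (hd : 0 < d) (hh : ∀ j, (h j).IsHomogeneous d)
    (hg : ∀ j, (g j).IsHomogeneous d) (he : ∀ j, (e j).IsHomogeneous d) (hca : c + a ≤ n)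
    (hhge : ∀ j, h j ∈ Ideal.span (Set.range g) ⊔ Ideal.span (Set.range e))
    (hdim : ringKrullDim (MvPolynomial (Fin (n + 1)) K ⧸ Ideal.span (Set.range g)) ≤
      (n + 1 - c : ℕ)) {Z : Set (ProjSpace n K)}
    (hZ : IsComponent (projZero (Ideal.span (Set.range g))) Z) :
    (Z ∩ projZero (Ideal.span (Set.range h))).Nonempty := by
  have hJ := Ideal.isHomogeneous_span_range hg
  obtain ⟨Q, hQ, hv, rfl⟩ := (isComponent_iff hJ).mp hZ
  have hQh := Ideal.isHomogeneous_of_mem_minimalPrimes hJ hQ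
  by_contra hempty
  -- A common zero of `Q` and the `e i` is a zero of every `h j`. If none exists off the origin, the
  -- cone over the component has dimension at most `a`, against `n + 1 - c > a`.
  have hrad : idealOfVars (Fin (n + 1)) K ≤ (Q ⊔ Ideal.span (Set.range e)).radical := by
    rw [← vanishingIdeal_zeroLocus_eq_radical (K := K)]
    refine Ideal.span_le.mpr ?_
    rintro _ ⟨i, rfl⟩
    rw [SetLike.mem_coe, mem_vanishingIdeal_iff]
    intro v hvz
    rw [aeval_X]
    by_contra hvi
    have hv0 : v ≠ 0 := fun h0 => hvi (congrFun h0 i)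
    have hvz' : ∀ f ∈ Q ⊔ Ideal.span (Set.range e), eval v f = 0 := fun f hf => by
      simpa [aeval_eq_eval] using hvz f hf
    refine hempty ⟨Projectivization.mk K v hv0, (mk_mem_projZero hQh hv0).mpr fun f hf =>
      hvz' f (Ideal.mem_sup_left hf), mem_projZero_span.mpr ?_⟩
    rintro _ ⟨j, rfl⟩
    rw [eval_rep_mk_eq_zero_iff (hh j)]
    exact hvz' _ (sup_le_sup_right hQ.1.2 _ (hhge j))
  have h1 := ringKrullDim_le_card_of_le_radical hQh e (fun _ => d) he (fun _ => hd) hrad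
  rw [ringKrullDim_eq_of_mem_minimalPrimes hd hg (by omega) hdim hQ, Fintype.card_fin] at h1
  have h2 : n + 1 - c ≤ a := by exact_mod_cast h1
  omega

theorem ringKrullDim_le_of_forall_isComponent {n c : ℕ} {K : Type*} [Field K] [IsAlgClosed K]
    {J : Ideal (MvPolynomial (Fin (n + 1)) K)}
    (hJ : J.IsHomogeneous (homogeneousSubmodule (Fin (n + 1)) K))
    (hZ : ∀ Z, IsComponent (projZero J) Z → coneDim Z ≤ (c : ℕ)) :
    ringKrullDim (MvPolynomial (Fin (n + 1)) K ⧸ J) ≤ (c : ℕ) := by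
  refine ringKrullDim_quotient_le_of_minimalPrimes fun Q hQ => ?_
  by_cases hv : idealOfVars (Fin (n + 1)) K ≤ Q
  · exact (ringKrullDim_quotient_le_zero hv).trans (by exact_mod_cast Nat.zero_le c)
  · rw [← coneDim_projZero hJ hQ hv]
    exact hZ _ (isComponent_projZero hJ hQ hv)

end ProjAlg

theorem proposition2p1 (k K : Type*) [Field k] [CharZero k] [Field K] [IsAlgClosed K] [Algebra k K]
    (n d r : ℕ) (hd : 1 ≤ d) (hr : r ≤ n)
    (W : Set (ProjAlg.ProjSpace n K))
    (hW : ProjAlg.IsCompleteIntersection k (fun _ : Fin r => d) W)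
    (hWsmooth : ∀ p ∈ W, ProjAlg.IsSmoothAt W p)
    (S : Set (MvPolynomial (Fin (n + 1)) k)) (hS : ∀ f ∈ S, ProjAlg.IsForm d f)
    (V : Set (ProjAlg.ProjSpace n K)) (hV : V = ⋂ f ∈ S, ProjAlg.hypersurface K f)
    (hWV : W ⊆ V) :
    (∃ c : ℕ, ProjAlg.IsCompleteIntersection k (fun _ : Fin c => d) V) ∧
      ∀ p ∈ W, ProjAlg.IsSmoothAt V p := by
  open ProjAlg in
  obtain ⟨hWdim, h₀, hform, hWeq, hWgen⟩ := hW
  set φ := map (σ := Fin (n + 1)) (algebraMap k K) with hφ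
  set h := fun j => φ (h₀ j) with hh_def
  have hh : ∀ j, (h j).IsHomogeneous d := fun j => (hform j).2.map _
  have hWJ : W = projZero (Ideal.span (Set.range h)) := hWeq.trans (iInter_hypersurface h₀)
  have hWcone : ringKrullDim (MvPolynomial (Fin (n + 1)) K ⧸ Ideal.span (Set.range h)) ≤
      (n + 1 - r : ℕ) :=
    ringKrullDim_le_of_forall_isComponent (Ideal.isHomogeneous_span_range hh) fun Z hZ =>
      ((WithBot.add_natCast_eq_iff (by omega)).mp (hWdim Z (hWJ ▸ hZ))).le
  have hWgen' : ∀ Z, IsComponent (projZero (Ideal.span (Set.range h))) Z →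
      ∃ x ∈ Z, LinearIndependent K fun j => gradientAt (h j) x := by
    intro Z hZ
    obtain ⟨U, -, ⟨x, hx⟩, hU⟩ := hWgen Z (hWJ ▸ hZ)
    refine ⟨x, hx.1, ?_⟩
    simpa only [hh_def, hφ, gradientAt_map] using hU x hx
  have hlinh : ∀ p ∈ W, LinearIndependent K fun j => gradientAt (h j) p := fun p hp =>
    (isSmoothAt_iff hd hh hr hWcone hWgen' (hWJ ▸ hp)).mp (hWJ ▸ hWsmooth p hp)
  have hWI := zeroIdeal_projZero_span hd hh hr hWcone hWgen'
  have hVS : ∀ x, x ∈ V ↔ ∀ f ∈ φ '' S, eval x.rep f = 0 := by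
    intro x
    simp [hV, mem_hypersurface, hφ]
  have hSd : ∀ f ∈ φ '' S, f.IsHomogeneous d := by
    rintro _ ⟨f, hf, rfl⟩
    exact (hS f hf).2.map _
  have hSspan : φ '' S ⊆ Submodule.span K (Set.range h) := by
    intro f hf
    refine mem_submodule_span_of_mem_span hh (hSd f hf) ?_
    -- Here `I(W) = (h)` turns vanishing on `W` into ideal membership.
    rw [← hWI, ← hWJ, mem_zeroIdeal_iff_rep (hSd f hf)]
    exact fun x hx => (hVS x).mp (hWV hx) f hf
  obtain ⟨c, a, g, e, hca, hgS, hgli, hSg, heh, hhge⟩ :=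
    exists_linearIndependent_fin_of_subset_span h _ hSspan
  rw [Fintype.card_fin] at hca
  choose g₀ hg₀S hg₀ using hgS
  have hg : ∀ j, (g j).IsHomogeneous d := fun j => hSd _ ⟨_, hg₀S j, hg₀ j⟩
  have he : ∀ j, (e j).IsHomogeneous d := fun j =>
    (Submodule.span_le (p := homogeneousSubmodule (Fin (n + 1)) K d)).mpr
      (Set.range_subset_iff.mpr hh) (heh j)
  have hspan_le : ∀ s : Set (MvPolynomial (Fin (n + 1)) K),
      Submodule.span K s ≤ (Ideal.span s).restrictScalars K := fun s =>
    Submodule.span_le.mpr Submodule.subset_span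
  have hhge' : ∀ j, h j ∈ Ideal.span (Set.range g) ⊔ Ideal.span (Set.range e) := fun j => by
    obtain ⟨y, hy, z, hz, hyz⟩ := Submodule.mem_sup.mp (hhge j)
    rw [← hyz]
    exact Submodule.add_mem_sup (hspan_le _ hy) (hspan_le _ hz)
  have hVeq : V = projZero (Ideal.span (Set.range g)) := by
    ext x
    rw [hVS, mem_projZero_span]
    refine ⟨fun hx f ⟨j, hj⟩ => hx f ⟨_, hg₀S j, (hg₀ j).trans hj⟩, fun hx f hf => ?_⟩
    exact mem_projZero_span.mpr hx f (hspan_le _ (hSg hf))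
  have hVcone : ringKrullDim (MvPolynomial (Fin (n + 1)) K ⧸ Ideal.span (Set.range g)) ≤
      (n + 1 - c : ℕ) := by
    -- Adding the `a` forms `e i` to the `g i` gives an ideal containing all `h j`, whose quotient
    -- has dimension at most `n + 1 - r`; moreover `c + a ≤ r`.
    refine (ringKrullDim_le_of_sup_span_le (Ideal.isHomogeneous_span_range hg) e (fun _ => d) he
      (fun _ => hd) (t := n + 1 - r) ((ringKrullDim_quotient_le_of_le ?_).trans hWcone)).trans ?_
    · exact Ideal.span_le.mpr (Set.range_subset_iff.mpr hhge')
    · rw [Fintype.card_fin]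
      exact_mod_cast (by omega : n + 1 - r + a ≤ n + 1 - c)
  have hling : ∀ p ∈ W, LinearIndependent K fun j => gradientAt (g j) p := fun p hp =>
    LinearIndependent.of_mem_span_of_map (gradientMap p) (h := h) (hlinh p hp) hgli
      fun i => hSspan ⟨_, hg₀S i, hg₀ i⟩
  have hcn : c ≤ n := by omega
  have hmeet : ∀ Z, IsComponent V Z → (Z ∩ W).Nonempty := fun Z hZ => by
    rw [hWJ]
    exact inter_nonempty_of_isComponent hd hh hg he (by omega) hhge' hVcone (hVeq ▸ hZ)
  refine ⟨⟨c, fun Z hZ => ?_, g₀, fun j => hS _ (hg₀S j), ?_, fun Z hZ => ?_⟩, fun p hp => ?_⟩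
  · exact (WithBot.add_natCast_eq_iff (by omega)).mpr
      (coneDim_eq_of_isComponent hd hg hcn hVcone (hVeq ▸ hZ))
  · rw [hVeq, iInter_hypersurface, show g = fun j => φ (g₀ j) from funext fun j => (hg₀ j).symm]
  · obtain ⟨p, hpZ, hpW⟩ := hmeet Z hZ
    -- Independence at one point of `Z ∩ W` spreads to an open neighbourhood, which is the generic
    -- part of `Z`.
    obtain ⟨U, hU, hpU, hUlin⟩ := exists_isOpen_linearIndependent hg (hling p hpW)
    refine ⟨U, hU, ⟨p, hpZ, hpU⟩, fun x hx => ?_⟩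
    simpa only [← hg₀, hφ, gradientAt_map] using hUlin x hx.2
  · have hgen : ∀ Z, IsComponent (projZero (Ideal.span (Set.range g))) Z →
        ∃ x ∈ Z, LinearIndependent K fun j => gradientAt (g j) x := fun Z hZ => by
      obtain ⟨x, hxZ, hxW⟩ := hmeet Z (hVeq ▸ hZ)
      exact ⟨x, hxZ, hling x hxW⟩
    have hpV := hWV hp
    rw [hVeq] at hpV ⊢
    exact (isSmoothAt_iff hd hg hcn hVcone hgen hpV).mpr (hling p hp)

end
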